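/- For $t\in\mathbb C$, $t\neq 0$, let $V_t=\{w\in\mathbb C^4:\ w_1^2+w_2^2+w_3^2+w_4^2=t\}$ be the smoothed conifold, let $r=\bigl(\sum_{i=1}^4|w_i|^2\bigr)^{1/2}$ (so that $r^2\ge |t|$ on $V_t$), and for $s\ge |t|$ put $$f_t(s)=2^{-\frac13}|t|^{\frac23}\int_0^{\cosh^{-1}(s/|t|)}(\sinh 2\tau-2\tau)^{\frac13}\,d\tau .$$ The function $f_t(r^2)$ is smooth on the complex threefold $V_t$, and $i\partial\bar\partial f_t(r^2)$ is a (positive definite) Kähler metric on $V_t$, the Candelas–de la Ossa metric. In local holomorphic coordinates $(z_1,z_2,z_3)$ on $V_t$ write $i\partial\bar\partial f_t(r^2)=i\sum g_{i\bar j}\,dz_i\wedge d\bar z_j$ and let $$R_{i\bar jk\bar l}=-\frac{\partial^2 g_{i\bar j}}{\partial z_k\,\partial\bar z_l}+\sum_{p,q}g^{p\bar q}\,\frac{\partial g_{i\bar q}}{\partial z_k}\,\frac{\partial g_{p\bar j}}{\partial\bar z_l}$$ be its curvature tensor, where $\sum_q g^{p\bar q}g_{i\bar q}=\delta_{ip}$.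 Then there is a constant $C$, independent of $t$ and $r$, such that for every $t\ne 0$ and every point $q\in V_t$ the following holds. There are local holomorphic coordinates $(z_1,z_2,z_3)$ on $V_t$ around $q$ that are orthonormal at $q$, i.e. in which $g_{i\bar j}(q)=\delta_{ij}$; and in every such coordinate system $$|R_{i\bar jk\bar l}(q)|\le C\,r(q)^{-\frac43}\qquad\text{for all } i,j,k,l\in\{1,2,3\}.$$ -/

import Mathlib

open Complex
open scoped ContDiff ComplexOrder

namespace Conifold

/-- The affine quadric `{w ∈ ℂ⁴ : w₁² + w₂² + w₃² + w₄² = t}`; for `t ≠ 0` this is the smoothed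
conifold. -/
def quadric (t : ℂ) : Set (Fin 4 → ℂ) :=
  {w | ∑ i, w i ^ 2 = t}

/-- The square `r² = ∑ |wᵢ|²` of the Euclidean radius on `ℂ⁴`. -/
noncomputable def radiusSq (w : Fin 4 → ℂ) : ℝ :=
  ∑ i, ‖w i‖ ^ 2

/-- The Euclidean radius `r` on `ℂ⁴`. -/
noncomputable def radius (w : Fin 4 → ℂ) : ℝ :=
  Real.sqrt (radiusSq w)

/-- The Candelas–de la Ossa profile
`f_t(s) = 2^(-1/3) |t|^(2/3) ∫₀^{arcosh (s/|t|)} (sinh 2τ - 2τ)^(1/3) dτ`.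
It is used for `s ≥ |t|` only, because `r² ≥ |t|` on the quadric. -/
noncomputable def profile (t : ℂ) (s : ℝ) : ℝ :=
  (2 : ℝ) ^ (-(1 / 3) : ℝ) * ‖t‖ ^ (2 / 3 : ℝ) *
    ∫ τ in (0 : ℝ)..Real.arcosh (s / ‖t‖), (Real.sinh (2 * τ) - 2 * τ) ^ (1 / 3 : ℝ)

/-- The Wirtinger derivative `∂h/∂zᵢ = ½ (∂h/∂xᵢ - √-1 ∂h/∂yᵢ)`, where `zᵢ = xᵢ + √-1 yᵢ`. -/
noncomputable def wirtinger (i : Fin 3) (h : (Fin 3 → ℂ) → ℂ) (z : Fin 3 → ℂ) : ℂ :=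
  (fderiv ℝ h z (Pi.single i 1) - I * fderiv ℝ h z (Pi.single i I)) / 2

/-- The Wirtinger derivative `∂h/∂z̄ᵢ = ½ (∂h/∂xᵢ + √-1 ∂h/∂yᵢ)`. -/
noncomputable def wirtingerBar (i : Fin 3) (h : (Fin 3 → ℂ) → ℂ) (z : Fin 3 → ℂ) : ℂ :=
  (fderiv ℝ h z (Pi.single i 1) + I * fderiv ℝ h z (Pi.single i I)) / 2

/-- The matrix `g_{i j̄} = ∂²F/∂zᵢ∂z̄ⱼ` of the form `√-1 ∂∂̄F = √-1 ∑ g_{i j̄} dzᵢ ∧ dz̄ⱼ`. -/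
noncomputable def kahlerMatrix (F : (Fin 3 → ℂ) → ℝ) (z : Fin 3 → ℂ) :
    Matrix (Fin 3) (Fin 3) ℂ :=
  Matrix.of fun i j => wirtinger i (wirtingerBar j fun x => (F x : ℂ)) z

/-- The curvature tensor of the Kähler metric `g_{i j̄} = ∂²F/∂zᵢ∂z̄ⱼ`,
`R_{i j̄ k l̄} = - ∂²g_{i j̄}/∂z_k∂z̄_l + ∑_{p,q} g^{p q̄} (∂g_{i q̄}/∂z_k) (∂g_{p j̄}/∂z̄_l)`.
Here `g^{p q̄}` is the `(q, p)` entry of the inverse of the matrix `(g_{i j̄})`. -/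
noncomputable def curvature (F : (Fin 3 → ℂ) → ℝ) (z : Fin 3 → ℂ) (i j k l : Fin 3) : ℂ :=
  -wirtinger k (wirtingerBar l fun x => kahlerMatrix F x i j) z +
    ∑ p, ∑ q, (kahlerMatrix F z)⁻¹ q p * wirtinger k (fun x => kahlerMatrix F x i q) z *
      wirtingerBar l (fun x => kahlerMatrix F x p j) z

/-- `e` is a system of local holomorphic coordinates `(z₁, z₂, z₃)` on the complex submanifold
`quadric t` of `ℂ⁴`: a homeomorphism from an open subset of `quadric t` onto an open subset
of `ℂ³` whose inverse is a holomorphic immersion into `ℂ⁴`. -/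
def IsHolomorphicChart {t : ℂ} (e : OpenPartialHomeomorph (quadric t) (Fin 3 → ℂ)) : Prop :=
  DifferentiableOn ℂ (fun z => (e.symm z : Fin 4 → ℂ)) e.target ∧
    ∀ z ∈ e.target, Function.Injective (fderiv ℂ (fun x => (e.symm x : Fin 4 → ℂ)) z)

/-- The Kähler potential `f_t(r²)` on `quadric t`, written in the coordinates `e`. -/
noncomputable def potential {t : ℂ} (e : OpenPartialHomeomorph (quadric t) (Fin 3 → ℂ))
    (z : Fin 3 → ℂ) : ℝ :=
  profile t (radiusSq (e.symm z : Fin 4 → ℂ))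

/-- `e` is a system of local holomorphic coordinates around `w` in which the metric
`√-1 ∂∂̄ f_t(r²)` equals `√-1 ∑ dzⱼ ∧ dz̄ⱼ` at the point `w`. -/
def IsOrthonormalChartAt {t : ℂ} (e : OpenPartialHomeomorph (quadric t) (Fin 3 → ℂ))
    (w : quadric t) : Prop :=
  IsHolomorphicChart e ∧ w ∈ e.source ∧ kahlerMatrix (potential e) (e w) = 1

end Conifold

/-! Put `s = r²` and `σ = r^(1/3)`. Two facts carry the estimate: a scale-invariant control of the
derivatives of `f_t`, and the independence of the curvature from tangential second derivatives of a
parametrisation.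

Since `f_t(s) = |t|^(2/3) f_1(s/|t|)`, only the slope of `f_1` has to be studied. It extends
smoothly past the tip `u = 1` and satisfies the radial Monge–Ampère equation (`slope_ode`).
Compactness near the tip and the differentiated equation away from it give decay like that of
`u^(2/3)` (`exists_slope_bound`); after rescaling, the `k`-th derivative of `f_t` is `O(σ^(4 - 6k))`
for `1 ≤ k ≤ 4`, uniformly in `t` (`exists_profileJet_bound`).

Let a chart have inverse `W`. The metric and its derivatives are Hermitian expressions in `W`, its
first derivatives `a p` and its second derivatives. The Monge–Ampère equation and a sharpened
Cauchy–Schwarz inequality on tangent vectors bound the metric below by a multiple of `σ⁻²` times the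
Euclidean one (`le_metricForm_self`), so orthonormality forces `a p = O(σ)`. The second derivatives
are arbitrary in tangential directions, but those parts cancel from the curvature
(`curvatureForm_add_sum`). The remaining part is fixed by differentiating `W · W = t` twice, and is
`O(σ⁻¹)`. With `w = O(σ³)`, every term of the curvature is then `O(σ⁻⁴) = O(r^(-4/3))`
(`norm_curvatureForm_le`). -/

/-! ### Smoothness of holomorphic maps in several variables. -/

/-- **Osgood's lemma**, the inductive step: a directional derivative of a holomorphic function of
several complex variables is again holomorphic. -/
theorem differentiableOn_fderiv_apply_complex {E F : Type*} [NormedAddCommGroup E]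
    [NormedSpace ℂ E] [FiniteDimensional ℂ E] [NormedAddCommGroup F] [NormedSpace ℂ F]
    [FiniteDimensional ℂ F] {U : Set E} (hU : IsOpen U) {f : E → F}
    (hf : DifferentiableOn ℂ f U) (v : E) :
    DifferentiableOn ℂ (fun z => fderiv ℂ f z v) U := by
  intro z₀ hz₀
  apply DifferentiableAt.differentiableWithinAt
  have : CompleteSpace F := FiniteDimensional.complete ℂ F
  let _ : MeasurableSpace E := borel E
  have : BorelSpace E := ⟨rfl⟩
  let _ : MeasurableSpace (E →L[ℂ] F) := borel _
  have : BorelSpace (E →L[ℂ] F) := ⟨rfl⟩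
  have : FiniteDimensional ℂ (E →L[ℂ] F) := inferInstance
  have : ProperSpace (E →L[ℂ] F) := FiniteDimensional.proper ℂ _
  have hfc : ContinuousAt f z₀ := (hf.differentiableAt (hU.mem_nhds hz₀)).continuousAt
  -- Three layers of radius `R`: `z` varies in the first, the shifts `ζ • v` reach the second, and
  -- the Cauchy estimate for the derivative there uses the third.
  obtain ⟨R, hR, hball⟩ : ∃ R > 0, ∀ z ∈ Metric.ball z₀ (3 * R), z ∈ U ∧ dist (f z) (f z₀) < 1 := by
    have h1 : ∀ᶠ z in nhds z₀, z ∈ U ∧ dist (f z) (f z₀) < 1 :=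
      Filter.Eventually.and (hU.mem_nhds hz₀) (hfc.eventually (Metric.ball_mem_nhds _ one_pos))
    obtain ⟨r, hr, h⟩ := Metric.eventually_nhds_iff_ball.1 h1
    exact ⟨r / 3, by positivity, fun z hz => h z (by simpa [mul_div_cancel₀] using hz)⟩
  obtain ⟨ε, hε, hεv⟩ : ∃ ε : ℝ, 0 < ε ∧ ε * ‖v‖ < R := by
    refine ⟨R / (‖v‖ + 1), by positivity, ?_⟩
    rw [div_mul_eq_mul_div, div_lt_iff₀ (by positivity)]
    nlinarith [norm_nonneg v]
  have hshift : ∀ z ∈ Metric.ball z₀ R, ∀ ζ : ℂ, ‖ζ‖ ≤ ε → z + ζ • v ∈ Metric.ball z₀ (2 * R) := by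
    intro z hz ζ hζ
    rw [Metric.mem_ball, dist_eq_norm] at hz ⊢
    calc ‖z + ζ • v - z₀‖ = ‖(z - z₀) + ζ • v‖ := by congr 1; abel
      _ ≤ ‖z - z₀‖ + ‖ζ‖ * ‖v‖ := (norm_add_le _ _).trans (by rw [norm_smul])
      _ < R + R := by nlinarith [norm_nonneg v]
      _ = 2 * R := by ring
  have hsub : Metric.ball z₀ (2 * R) ⊆ U := fun z hz =>
    (hball z (Metric.ball_subset_ball (by linarith) hz)).1
  have hfd : ∀ y ∈ Metric.ball z₀ (2 * R), ‖fderiv ℂ f y‖ ≤ 2 / R := by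
    intro y hy
    have hyy : Metric.ball y R ⊆ Metric.ball z₀ (3 * R) :=
      Metric.ball_subset_ball' (by rw [Metric.mem_ball] at hy; linarith)
    refine norm_fderiv_le_div_of_mapsTo_ball (hf.mono fun z hz => (hball z (hyy hz)).1) ?_ hR
    intro z hz
    have h1 := (hball z (hyy hz)).2
    have h2 := (hball y (hyy (Metric.mem_ball_self hR))).2
    rw [Metric.mem_closedBall]
    linarith [dist_triangle_right (f z) (f y) (f z₀)]
  have hcm : ∀ θ : ℝ, ‖circleMap 0 ε θ‖ ≤ ε := fun θ => by
    simp [abs_of_pos hε]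
  -- One-variable Cauchy formula on the complex line through `z` in direction `v`. It involves only
  -- values of `f`, so it can be differentiated in `z` under the integral sign.
  have hcauchy : ∀ z ∈ Metric.ball z₀ R, (2 * Real.pi * I : ℂ)⁻¹ •
      (∫ θ in (0 : ℝ)..2 * Real.pi, (deriv (circleMap 0 ε) θ * ((circleMap 0 ε θ) ^ 2)⁻¹) •
        f (z + circleMap 0 ε θ • v)) = fderiv ℂ f z v := by
    intro z hz
    have hline : ∀ ζ : ℂ, HasDerivAt (fun ζ : ℂ => z + ζ • v) v ζ := fun ζ => by
      simpa using ((hasDerivAt_id ζ).smul_const v).const_add z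
    have hopen : IsOpen ((fun ζ : ℂ => z + ζ • v) ⁻¹' U) :=
      hU.preimage (by fun_prop)
    have hd : DifferentiableOn ℂ (fun ζ : ℂ => f (z + ζ • v)) ((fun ζ : ℂ => z + ζ • v) ⁻¹' U) := by
      intro ζ hζ
      exact ((hf.differentiableAt (hU.mem_nhds hζ)).comp ζ
        (hline ζ).differentiableAt).differentiableWithinAt
    have h := Complex.two_pi_I_inv_smul_circleIntegral_sub_sq_inv_smul_of_differentiable hopen
      (c := 0) (w₀ := 0) (R := ε)
      (fun ζ hζ => hsub (hshift z hz ζ (by simpa using hζ))) hd (Metric.mem_ball_self hε)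
    have hz0 : z ∈ U := by
      simpa using hsub (hshift z hz 0 (by simpa using hε.le))
    have h2 : deriv (fun ζ : ℂ => f (z + ζ • v)) 0 = fderiv ℂ f z v := by
      have h3 : HasFDerivAt f (fderiv ℂ f z) (z + (0 : ℂ) • v) := by
        simpa using (hf.differentiableAt (hU.mem_nhds hz0)).hasFDerivAt
      exact (h3.comp_hasDerivAt (0 : ℂ) (hline 0)).deriv
    rw [← h2, ← h, circleIntegral]
    simp only [sub_zero, smul_smul]
  set c : ℝ → ℂ := fun θ => deriv (circleMap 0 ε) θ * ((circleMap 0 ε θ) ^ 2)⁻¹ with hc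
  have hne : ∀ θ, circleMap 0 ε θ ≠ 0 := fun θ => circleMap_ne_center hε.ne'
  have hccont : Continuous c := by
    have h1 : Continuous fun θ => deriv (circleMap 0 ε) θ := by
      simp only [deriv_circleMap]; fun_prop
    exact h1.mul (((continuous_circleMap 0 ε).pow 2).inv₀ fun θ => pow_ne_zero 2 (hne θ))
  have hFcont : ∀ z ∈ Metric.ball z₀ R, Continuous fun θ : ℝ =>
      c θ • f (z + circleMap 0 ε θ • v) := by
    intro z hz
    refine hccont.smul ?_
    refine continuous_iff_continuousAt.2 fun θ => ?_
    exact ContinuousAt.comp (f := fun θ : ℝ => z + circleMap 0 ε θ • v)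
      (hf.differentiableAt (hU.mem_nhds (hsub (hshift z hz _ (hcm θ))))).continuousAt
      (by fun_prop)
  have hmain : HasFDerivAt (fun z => ∫ θ in (0 : ℝ)..2 * Real.pi,
      c θ • f (z + circleMap 0 ε θ • v))
      (∫ θ in (0 : ℝ)..2 * Real.pi, c θ • fderiv ℂ f (z₀ + circleMap 0 ε θ • v)) z₀ := by
    refine intervalIntegral.hasFDerivAt_integral_of_dominated_of_fderiv_le
      (F' := fun z θ => c θ • fderiv ℂ f (z + circleMap 0 ε θ • v))
      (s := Metric.ball z₀ R) (bound := fun θ => ‖c θ‖ * (2 / R)) (Metric.ball_mem_nhds _ hR)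
      ?_ ?_ ?_ ?_ ?_ ?_
    · filter_upwards [Metric.ball_mem_nhds _ hR] with z hz
      exact (hFcont z hz).aestronglyMeasurable
    · exact (hFcont z₀ (Metric.mem_ball_self hR)).intervalIntegrable _ _
    -- Continuity of the derivative is not yet known; measurability suffices here.
    · refine (hccont.measurable.aestronglyMeasurable).smul ?_
      refine Measurable.aestronglyMeasurable ?_
      exact (measurable_fderiv ℂ f).comp
        (Continuous.measurable (by fun_prop : Continuous fun θ : ℝ => z₀ + circleMap 0 ε θ • v))
    · refine Filter.Eventually.of_forall fun θ _ z hz => ?_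
      rw [norm_smul]
      exact mul_le_mul_of_nonneg_left (hfd _ (hshift z hz _ (hcm θ))) (norm_nonneg _)
    · exact (hccont.norm.mul continuous_const).intervalIntegrable _ _
    · refine Filter.Eventually.of_forall fun θ _ z hz => ?_
      have h3 := (hf.differentiableAt (hU.mem_nhds (hsub (hshift z hz _ (hcm θ))))).hasFDerivAt
      exact ((h3.comp z ((hasFDerivAt_id z).add_const _)).const_smul (c θ))
  refine ((hmain.differentiableAt.const_smul ((2 * Real.pi * I : ℂ)⁻¹))).congr_of_eventuallyEq ?_
  filter_upwards [Metric.ball_mem_nhds _ hR] with z hz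
  exact (hcauchy z hz).symm

/-- Holomorphic functions of several complex variables are smooth. -/
theorem contDiffOn_infty_of_differentiableOn_complex {E F : Type*} [NormedAddCommGroup E]
    [NormedSpace ℂ E] [FiniteDimensional ℂ E] [NormedAddCommGroup F] [NormedSpace ℂ F]
    [FiniteDimensional ℂ F] {U : Set E} (hU : IsOpen U) {f : E → F}
    (hf : DifferentiableOn ℂ f U) : ContDiffOn ℂ ∞ f U := by
  rw [contDiffOn_infty]
  intro n
  induction n generalizing f with
  | zero => exact contDiffOn_zero.2 hf.continuousOn
  | succ n ih =>
    have h := contDiffOn_succ_iff_fderiv_of_isOpen (𝕜 := ℂ) (n := n) (f := f) hU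
    push_cast
    rw [h]
    refine ⟨hf, by simp, ?_⟩
    rw [contDiffOn_clm_apply]
    exact fun v => ih (differentiableOn_fderiv_apply_complex hU hf v)

/-! ### The cube of the slope, regular at the tip. -/

namespace Conifold

open Set in
/-- Iterated derivatives given explicitly on an open set make a function smooth there. -/
theorem contDiffOn_infty_of_hasDerivAt {U : Set ℝ} (hU : IsOpen U) {f : ℕ → ℝ → ℝ}
    (h : ∀ k, ∀ u ∈ U, HasDerivAt (f k) (f (k + 1) u) u) (k : ℕ) : ContDiffOn ℝ ∞ (f k) U := by
  rw [contDiffOn_infty]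
  intro n
  induction n generalizing k with
  | zero => exact contDiffOn_zero.2 fun u hu => (h k u hu).continuousAt.continuousWithinAt
  | succ n ih =>
    have := contDiffOn_succ_iff_deriv_of_isOpen (𝕜 := ℝ) (n := n) (f := f k) hU
    push_cast
    rw [this]
    exact ⟨fun u hu => (h k u hu).differentiableAt.differentiableWithinAt, by simp,
      (ih (k + 1)).congr fun u hu => (h k u hu).deriv⟩

/-- The integrals `∫₀¹ y^(2k+2) (2 + y² (u - 1))^(1/2 - k) dy`. -/
noncomputable def tipIntegral (k : ℕ) (u : ℝ) : ℝ :=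
  ∫ y in (0 : ℝ)..1, y ^ (2 * k + 2) * (2 + y ^ 2 * (u - 1)) ^ (1 / 2 - k : ℝ)

/-- The base is a convex combination of `2` and `u + 1`. It stays away from zero on both sides of
the tip, which makes the tip integrals smooth there. -/
theorem one_le_tip_base {u y : ℝ} (hu : 0 ≤ u) (hy : y ∈ Set.Icc (0 : ℝ) 1) :
    1 ≤ 2 + y ^ 2 * (u - 1) := by
  have h1 : y ^ 2 ≤ 1 := pow_le_one₀ hy.1 hy.2
  nlinarith [mul_nonneg (sq_nonneg y) hu]

theorem continuousOn_tip_integrand (k : ℕ) {u : ℝ} (hu : 0 ≤ u) (m : ℕ) :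
    ContinuousOn (fun y : ℝ => y ^ m * (2 + y ^ 2 * (u - 1)) ^ (1 / 2 - k : ℝ))
      (Set.Icc 0 1) := by
  refine ContinuousOn.mul (by fun_prop) ?_
  refine ContinuousOn.rpow_const (by fun_prop) fun y hy => Or.inl ?_
  linarith [one_le_tip_base hu hy]

theorem intervalIntegrable_tip (k : ℕ) {u : ℝ} (hu : 0 ≤ u) (m : ℕ) :
    IntervalIntegrable (fun y : ℝ => y ^ m * (2 + y ^ 2 * (u - 1)) ^ (1 / 2 - k : ℝ))
      MeasureTheory.volume 0 1 :=
  ContinuousOn.intervalIntegrable (by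
    rw [Set.uIcc_of_le zero_le_one]; exact continuousOn_tip_integrand k hu m)

/-- The differentiated integrand has a negative exponent over a base at least `1`, so a constant
dominates it. -/
theorem hasDerivAt_tipIntegral (k : ℕ) {u : ℝ} (hu : 0 < u) :
    HasDerivAt (tipIntegral k) ((1 / 2 - k) * tipIntegral (k + 1) u) u := by
  have key := intervalIntegral.hasDerivAt_integral_of_dominated_loc_of_deriv_le
    (μ := MeasureTheory.volume) (a := 0) (b := 1)
    (F := fun u y : ℝ => y ^ (2 * k + 2) * (2 + y ^ 2 * (u - 1)) ^ (1 / 2 - k : ℝ))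
    (F' := fun u y : ℝ => (1 / 2 - k) *
      (y ^ (2 * (k + 1) + 2) * (2 + y ^ 2 * (u - 1)) ^ (1 / 2 - (k + 1 : ℕ) : ℝ)))
    (x₀ := u) (s := Set.Ioi 0) (bound := fun _ => |1 / 2 - (k : ℝ)|) (Ioi_mem_nhds hu)
    ?_ (intervalIntegrable_tip k hu.le _) ?_ ?_ (intervalIntegrable_const) ?_
  · have h2 := key.2
    rw [intervalIntegral.integral_const_mul] at h2
    exact h2
  · exact Filter.Eventually.of_forall fun x => by
      exact (Measurable.aestronglyMeasurable (by fun_prop))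
  · exact (Measurable.aestronglyMeasurable (by fun_prop))
  · refine Filter.Eventually.of_forall fun y hy x hx => ?_
    rw [Set.uIoc_of_le zero_le_one] at hy
    have hy' : y ∈ Set.Icc (0 : ℝ) 1 := ⟨hy.1.le, hy.2⟩
    have hb := one_le_tip_base (le_of_lt hx) hy'
    rw [norm_mul, Real.norm_eq_abs]
    refine mul_le_of_le_one_right (abs_nonneg _) ?_
    rw [Real.norm_of_nonneg (mul_nonneg (pow_nonneg hy'.1 _) (Real.rpow_nonneg (by linarith) _))]
    refine mul_le_one₀ (pow_le_one₀ hy'.1 hy'.2) (Real.rpow_nonneg (by linarith) _) ?_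
    refine Real.rpow_le_one_of_one_le_of_nonpos hb ?_
    push_cast
    linarith [Nat.cast_nonneg (α := ℝ) k]
  · refine Filter.Eventually.of_forall fun y hy x hx => ?_
    rw [Set.uIoc_of_le zero_le_one] at hy
    have hb := one_le_tip_base (le_of_lt hx) ⟨hy.1.le, hy.2⟩
    have h1 : HasDerivAt (fun x : ℝ => 2 + y ^ 2 * (x - 1)) (y ^ 2) x := by
      simpa using (((hasDerivAt_id x).sub_const 1).const_mul (y ^ 2)).const_add 2
    have h2 := (h1.rpow_const (p := (1 / 2 - k : ℝ)) (Or.inl (by linarith))).const_mul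
      (y ^ (2 * k + 2))
    convert! h2 using 1
    rw [show (1 / 2 - (k : ℝ) - 1) = 1 / 2 - (k + 1 : ℕ) by push_cast; ring]
    ring

theorem contDiffOn_tipIntegral : ContDiffOn ℝ ∞ (tipIntegral 0) (Set.Ioi 0) := by
  have := contDiffOn_infty_of_hasDerivAt (U := Set.Ioi 0) isOpen_Ioi
    (f := fun k u => (∏ j ∈ Finset.range k, (1 / 2 - (j : ℝ))) * tipIntegral k u)
    (fun k u hu => by
      have := (hasDerivAt_tipIntegral k hu).const_mul (∏ j ∈ Finset.range k, (1 / 2 - (j : ℝ)))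
      rw [← mul_assoc] at this
      simpa only [Finset.prod_range_succ] using this) 0
  simpa using this

theorem tipIntegral_zero_eq (u : ℝ) :
    tipIntegral 0 u = ∫ y in (0 : ℝ)..1, y ^ 2 * √(2 + y ^ 2 * (u - 1)) := by
  simp only [tipIntegral, Real.sqrt_eq_rpow]
  norm_num

theorem intervalIntegrable_tip_sqrt (u : ℝ) :
    IntervalIntegrable (fun y : ℝ => y ^ 2 * √(2 + y ^ 2 * (u - 1))) MeasureTheory.volume 0 1 :=
  Continuous.intervalIntegrable (by fun_prop) _ _

theorem tipIntegral_zero_pos {u : ℝ} (hu : 0 < u) : 0 < tipIntegral 0 u := by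
  have h : ∫ y in (0 : ℝ)..1, y ^ 2 ≤ tipIntegral 0 u := by
    rw [tipIntegral_zero_eq]
    refine intervalIntegral.integral_mono_on zero_le_one
      (Continuous.intervalIntegrable (by fun_prop) _ _)
      (intervalIntegrable_tip_sqrt u) fun y hy => ?_
    exact le_mul_of_one_le_right (sq_nonneg y) (Real.one_le_sqrt.2 (one_le_tip_base hu.le hy))
  rw [integral_pow] at h
  norm_num at h
  linarith

/-- The radicand is at least `y² u` on `[0, 1]`. The companion upper bound uses that it is at most
`u + 1 ≤ (9/4) u`. -/
theorem sqrt_div_four_le_tipIntegral {u : ℝ} (hu : 1 ≤ u) : √u / 4 ≤ tipIntegral 0 u := by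
  have h : ∫ y in (0 : ℝ)..1, y ^ 3 * √u ≤ tipIntegral 0 u := by
    rw [tipIntegral_zero_eq]
    refine intervalIntegral.integral_mono_on zero_le_one
      (Continuous.intervalIntegrable (by fun_prop) _ _)
      (intervalIntegrable_tip_sqrt u) fun y hy => ?_
    have h1 : y * √u ≤ √(2 + y ^ 2 * (u - 1)) := by
      refine Real.le_sqrt_of_sq_le ?_
      rw [mul_pow, Real.sq_sqrt (by linarith)]
      nlinarith [pow_le_one₀ (n := 2) hy.1 hy.2]
    calc y ^ 3 * √u = y ^ 2 * (y * √u) := by ring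
      _ ≤ _ := mul_le_mul_of_nonneg_left h1 (sq_nonneg y)
  rw [intervalIntegral.integral_mul_const, integral_pow] at h
  norm_num at h
  linarith

theorem tipIntegral_le_sqrt_div_two {u : ℝ} (hu : 1 ≤ u) : tipIntegral 0 u ≤ √u / 2 := by
  have h : tipIntegral 0 u ≤ ∫ y in (0 : ℝ)..1, y ^ 2 * ((3 / 2) * √u) := by
    rw [tipIntegral_zero_eq]
    refine intervalIntegral.integral_mono_on zero_le_one
      (intervalIntegrable_tip_sqrt u)
      (Continuous.intervalIntegrable (by fun_prop) _ _) fun y hy => ?_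
    refine mul_le_mul_of_nonneg_left ?_ (sq_nonneg y)
    refine Real.sqrt_le_iff.2 ⟨by positivity, ?_⟩
    rw [mul_pow, Real.sq_sqrt (by linarith)]
    nlinarith [pow_le_one₀ (n := 2) hy.1 hy.2]
  rw [intervalIntegral.integral_mul_const, integral_pow] at h
  norm_num at h
  linarith

/-- Integrate the `y`-derivative of `y³ √(2 + y² (u - 1))` over `[0, 1]`; the right side is its
boundary value. -/
theorem tipIntegral_ode {u : ℝ} (hu : 0 < u) :
    (u - 1) * tipIntegral 1 u + 3 * tipIntegral 0 u = √(u + 1) := by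
  have h := intervalIntegral.integral_eq_sub_of_hasDerivAt (a := 0) (b := 1)
    (f := fun y : ℝ => y ^ 3 * √(2 + y ^ 2 * (u - 1)))
    (f' := fun y : ℝ => (u - 1) * (y ^ (2 * 1 + 2) * (2 + y ^ 2 * (u - 1)) ^ (1 / 2 - (1 : ℕ) : ℝ))
      + 3 * (y ^ (2 * 0 + 2) * (2 + y ^ 2 * (u - 1)) ^ (1 / 2 - (0 : ℕ) : ℝ))) ?_ ?_
  · rw [intervalIntegral.integral_add, intervalIntegral.integral_const_mul,
      intervalIntegral.integral_const_mul] at h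
    · have h2 : (2 + (1 : ℝ) ^ 2 * (u - 1)) = u + 1 := by ring
      rw [h2] at h
      simpa [tipIntegral] using h
    · exact (intervalIntegrable_tip 1 hu.le _).const_mul _
    · exact (intervalIntegrable_tip 0 hu.le _).const_mul _
  · intro y hy
    rw [Set.uIcc_of_le zero_le_one] at hy
    have hb := one_le_tip_base hu.le hy
    have h1 : HasDerivAt (fun y : ℝ => 2 + y ^ 2 * (u - 1)) (2 * y * (u - 1)) y := by
      simpa using ((hasDerivAt_pow 2 y).mul_const (u - 1)).const_add 2
    have h2 := (hasDerivAt_pow 3 y).mul (h1.sqrt (by linarith))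
    refine h2.congr_deriv ?_
    have h3 : (2 + y ^ 2 * (u - 1)) ^ (1 / 2 - (1 : ℕ) : ℝ) = 1 / √(2 + y ^ 2 * (u - 1)) := by
      rw [Real.sqrt_eq_rpow, one_div (_ ^ _), ← Real.rpow_neg (by linarith)]
      norm_num
    have h4 : (2 + y ^ 2 * (u - 1)) ^ (1 / 2 - (0 : ℕ) : ℝ) = √(2 + y ^ 2 * (u - 1)) := by
      rw [Real.sqrt_eq_rpow]
      norm_num
    rw [h3, h4]
    have : 0 < √(2 + y ^ 2 * (u - 1)) := Real.sqrt_pos.2 (by linarith)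
    field_simp
    norm_num
    ring
  · exact ((intervalIntegrable_tip 1 hu.le _).const_mul _).add
      ((intervalIntegrable_tip 0 hu.le _).const_mul _)

/-- The cube `(sinh 2τ - 2τ) / (2 sinh³ τ)` of the slope of the profile, at `u = cosh τ`, in a form
that is regular at the tip `u = 1`. -/
noncomputable def slopeCube (u : ℝ) : ℝ := 4 * tipIntegral 0 u / √(u + 1) ^ 3

theorem slopeCube_pos {u : ℝ} (hu : 0 < u) : 0 < slopeCube u :=
  div_pos (mul_pos (by norm_num) (tipIntegral_zero_pos hu))
    (pow_pos (Real.sqrt_pos.2 (by linarith)) 3)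

theorem contDiffOn_slopeCube : ContDiffOn ℝ ∞ slopeCube (Set.Ioi 0) := by
  unfold slopeCube
  refine (contDiffOn_const.mul contDiffOn_tipIntegral).div (ContDiffOn.pow ?_ 3) ?_
  · refine ContDiffOn.sqrt (by fun_prop) fun u hu => ?_
    have : (0 : ℝ) < u := hu
    positivity
  · intro u hu
    have : (0 : ℝ) < u := hu
    positivity

/-- For `u > 1` this says that `(u² - 1)^(3/2) slopeCube` has derivative `2 √(u² - 1)`. The solution
regular at `1` is `2 (u² - 1)^(-3/2) ∫₁ᵘ √(v² - 1) dv`, and the substitution `v = 1 + y² (u - 1)`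
produces the formula with `tipIntegral`. -/
theorem slopeCube_ode {u : ℝ} (hu : 0 < u) :
    (u ^ 2 - 1) * deriv slopeCube u + 3 * u * slopeCube u = 2 := by
  have hp : 0 < √(u + 1) := Real.sqrt_pos.2 (by linarith)
  have hp2 : √(u + 1) ^ 2 = u + 1 := Real.sq_sqrt (by linarith)
  have h1 : HasDerivAt (fun u : ℝ => √(u + 1)) (1 / (2 * √(u + 1))) u := by
    simpa using ((hasDerivAt_id u).add_const 1).sqrt (by simpa using (by linarith : u + 1 ≠ 0))
  have h2 := ((hasDerivAt_tipIntegral 0 hu).const_mul 4).div (h1.pow 3) (pow_pos hp 3).ne'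
  have h3 : deriv slopeCube u = _ := h2.deriv
  have hode := tipIntegral_ode hu
  rw [h3, slopeCube]
  simp only [Nat.cast_zero, zero_add, sub_zero, Pi.pow_apply]
  generalize √(u + 1) = p at *
  obtain rfl : u = p ^ 2 - 1 := by linarith
  set A := tipIntegral 1 (p ^ 2 - 1)
  set B := tipIntegral 0 (p ^ 2 - 1)
  field_simp
  norm_num
  linear_combination (4 : ℝ) * p ^ 6 * hode

end Conifold

/-! ### The slope of the unit profile: Monge–Ampère equation and decay of derivatives. -/

namespace Conifold

/-- The derivative of the profile with `‖t‖ = 1`, in a form that is regular at the tip `u = 1`. -/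
noncomputable def slope (u : ℝ) : ℝ := slopeCube u ^ (1 / 3 : ℝ)

theorem slope_pos {u : ℝ} (hu : 0 < u) : 0 < slope u := Real.rpow_pos_of_pos (slopeCube_pos hu) _

theorem slope_pow_three {u : ℝ} (hu : 0 < u) : slope u ^ 3 = slopeCube u := by
  rw [slope, ← Real.rpow_natCast, ← Real.rpow_mul (slopeCube_pos hu).le]
  norm_num

theorem contDiffOn_slope : ContDiffOn ℝ ∞ slope (Set.Ioi 0) :=
  contDiffOn_slopeCube.rpow_const_of_ne fun _ hu => (slopeCube_pos hu).ne'

theorem contDiffOn_iterate_deriv_slope (k : ℕ) :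
    ContDiffOn ℝ ∞ (deriv^[k] slope) (Set.Ioi 0) := by
  induction k with
  | zero => exact contDiffOn_slope
  | succ k ih =>
    rw [Function.iterate_succ_apply']
    exact ((contDiffOn_infty_iff_deriv_of_isOpen isOpen_Ioi).1 ih).2

theorem hasDerivAt_iterate_deriv_slope (k : ℕ) {u : ℝ} (hu : 0 < u) :
    HasDerivAt (deriv^[k] slope) (deriv^[k + 1] slope u) u := by
  rw [Function.iterate_succ_apply']
  exact (((contDiffOn_iterate_deriv_slope k).differentiableOn (by simp)).differentiableAt
    (Ioi_mem_nhds hu)).hasDerivAt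

/-- The radial form of the Monge–Ampère equation behind Ricci-flatness. It serves both the
derivative bounds and the lower bound for the metric. -/
theorem slope_ode {u : ℝ} (hu : 0 < u) :
    slope u ^ 2 * ((u ^ 2 - 1) * deriv slope u + u * slope u) = 2 / 3 := by
  have h1 : HasDerivAt slopeCube (3 * slope u ^ 2 * deriv slope u) u := by
    have h := (hasDerivAt_iterate_deriv_slope 0 hu).pow 3
    refine (h.congr_of_eventuallyEq ?_).congr_deriv (by simp)
    filter_upwards [Ioi_mem_nhds hu] with v hv
    exact (slope_pow_three hv).symm
  have h2 := slopeCube_ode hu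
  rw [h1.deriv, ← slope_pow_three hu] at h2
  linarith

/-- The profile with `‖t‖ = 1`, extended smoothly past the tip `u = 1`. -/
noncomputable def unitProfile (u : ℝ) : ℝ := ∫ v in (1 : ℝ)..u, slope v

theorem hasDerivAt_unitProfile {u : ℝ} (hu : 0 < u) : HasDerivAt unitProfile (slope u) u := by
  have hsub : Set.uIcc 1 u ⊆ Set.Ioi 0 := fun v hv => lt_of_lt_of_le (lt_min one_pos hu) hv.1
  refine intervalIntegral.integral_hasDerivAt_right
    ((contDiffOn_slope.continuousOn.mono hsub).intervalIntegrable) ?_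
    (contDiffOn_slope.continuousOn.continuousAt (Ioi_mem_nhds hu))
  exact contDiffOn_slope.continuousOn.stronglyMeasurableAtFilter isOpen_Ioi u hu

/-- By `slopeCube_ode` both sides have derivative `2 sinh² τ`, and both vanish at `0`. No division
by `sinh τ` is needed at the tip. -/
theorem slopeCube_cosh (τ : ℝ) :
    slopeCube (Real.cosh τ) * Real.sinh τ ^ 3 = (Real.sinh (2 * τ) - 2 * τ) / 2 := by
  have hd : ∀ σ : ℝ, HasDerivAt (fun σ => slopeCube (Real.cosh σ) * Real.sinh σ ^ 3 -
      (Real.sinh (2 * σ) - 2 * σ) / 2) 0 σ := by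
    intro σ
    have hc := Real.cosh_pos σ
    have h1 : HasDerivAt slopeCube (deriv slopeCube (Real.cosh σ)) (Real.cosh σ) :=
      ((contDiffOn_slopeCube.differentiableOn (by simp)).differentiableAt
        (Ioi_mem_nhds hc)).hasDerivAt
    have h2 := (h1.comp σ (Real.hasDerivAt_cosh σ)).mul ((Real.hasDerivAt_sinh σ).pow 3)
    have h3 : HasDerivAt (fun σ : ℝ => 2 * σ) 2 σ := by
      simpa using (hasDerivAt_id σ).const_mul (2 : ℝ)
    have h4 := ((h3.sinh).sub h3).div_const 2
    refine (h2.sub h4).congr_deriv ?_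
    have hode := slopeCube_ode hc
    have hsq := Real.cosh_sq σ
    rw [Real.cosh_two_mul]
    simp only [Function.comp_apply, Pi.pow_apply]
    push_cast
    linear_combination Real.sinh σ ^ 2 * hode +
      (-1 - Real.sinh σ ^ 2 * deriv slopeCube (Real.cosh σ)) * hsq
  have hconst := is_const_of_deriv_eq_zero (fun σ => (hd σ).differentiableAt)
    (fun σ => (hd σ).deriv) τ 0
  simp at hconst
  linarith

/-- Substitution `u = cosh τ`, with the slope read off from `slopeCube_cosh`. -/
theorem unitProfile_eq {u : ℝ} (hu : 1 ≤ u) : unitProfile u =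
    (2 : ℝ) ^ (-(1 / 3) : ℝ) *
      ∫ τ in (0 : ℝ)..Real.arcosh u, (Real.sinh (2 * τ) - 2 * τ) ^ (1 / 3 : ℝ) := by
  have h := intervalIntegral.integral_eq_sub_of_hasDerivAt (a := 0) (b := Real.arcosh u)
    (f := fun τ => unitProfile (Real.cosh τ))
    (f' := fun τ => (2 : ℝ) ^ (-(1 / 3) : ℝ) * (Real.sinh (2 * τ) - 2 * τ) ^ (1 / 3 : ℝ)) ?_ ?_
  · rw [intervalIntegral.integral_const_mul, Real.cosh_arcosh hu, Real.cosh_zero] at h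
    rw [h]
    simp [unitProfile]
  · intro τ hτ
    rw [Set.uIcc_of_le (Real.arcosh_nonneg hu)] at hτ
    have hs : 0 ≤ Real.sinh τ := Real.sinh_nonneg_iff.2 hτ.1
    have hc := Real.cosh_pos τ
    refine ((hasDerivAt_unitProfile hc).comp τ (Real.hasDerivAt_cosh τ)).congr_deriv ?_
    have h1 : Real.sinh (2 * τ) - 2 * τ = 2 * (slopeCube (Real.cosh τ) * Real.sinh τ ^ 3) := by
      rw [slopeCube_cosh]; ring
    have h0 := (slopeCube_pos hc).le
    rw [h1, Real.mul_rpow (by norm_num) (by positivity), Real.mul_rpow h0 (by positivity),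
      ← mul_assoc, ← Real.rpow_add (by norm_num), ← Real.rpow_natCast (Real.sinh τ),
      ← Real.rpow_mul hs, slope]
    norm_num
  · refine Continuous.intervalIntegrable ?_ _ _
    refine continuous_const.mul (Continuous.rpow_const ?_ fun _ => Or.inr (by norm_num))
    exact (Real.continuous_sinh.comp (by fun_prop)).sub (by fun_prop)

theorem slope_cube_bounds {u : ℝ} (hu : 1 ≤ u) :
    1 / 8 ≤ u * slope u ^ 3 ∧ u * slope u ^ 3 ≤ 2 := by
  have hu0 : 0 < u := by linarith
  have h1 := sqrt_div_four_le_tipIntegral hu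
  have h2 := tipIntegral_le_sqrt_div_two hu
  rw [slope_pow_three hu0, slopeCube]
  have hq : 0 < √u := Real.sqrt_pos.2 hu0
  have hq2 : √u ^ 2 = u := Real.sq_sqrt hu0.le
  have hp2 : √(u + 1) ^ 2 = u + 1 := Real.sq_sqrt (by linarith)
  have hqp : √u ≤ √(u + 1) := Real.sqrt_le_sqrt (by linarith)
  have hpq : √(u + 1) ≤ 2 * √u := by
    refine Real.sqrt_le_iff.2 ⟨by positivity, ?_⟩
    rw [mul_pow, hq2]; linarith
  have hp : 0 < √(u + 1) := hq.trans_le hqp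
  generalize √u = q at *
  generalize √(u + 1) = p at *
  generalize tipIntegral 0 u = A at *
  rw [← hq2]
  have h3 : q ^ 3 ≤ p ^ 3 := pow_le_pow_left₀ hq.le hqp 3
  have h4 : p ^ 3 ≤ (2 * q) ^ 3 := pow_le_pow_left₀ hp.le hpq 3
  have h5 : q ^ 2 * (q / 4) ≤ q ^ 2 * A := by gcongr
  have h6 : q ^ 2 * A ≤ q ^ 2 * (q / 2) := by gcongr
  rw [← mul_div_assoc]
  constructor
  · rw [le_div_iff₀ (by positivity)]
    nlinarith
  · rw [div_le_iff₀ (by positivity)]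
    nlinarith

/-- Here `g_k` stands for `u^(1/3) u^k` times the `k`-th derivative of the slope, and `e` for `u⁻²`.
Each equation is solved for its highest-order term, dividing by `g₀` and by `1 - e ≥ 3/4`; the
numerical constants are crude. -/
theorem scaled_ode_bounds {g₀ g₁ g₂ g₃ e : ℝ} (h0 : 1 / 2 ≤ g₀) (h0' : g₀ ≤ 2)
    (he' : e ≤ 1 / 4) (hY0 : g₀ ^ 2 * ((1 - e) * g₁ + g₀) = 2 / 3)
    (hY1 : 2 * g₁ * ((1 - e) * g₁ + g₀) + g₀ * ((1 - e) * g₂ + 3 * g₁ + g₀) = 0)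
    (hY2 : 2 * g₂ * ((1 - e) * g₁ + g₀) + 3 * g₁ * ((1 - e) * g₂ + 3 * g₁ + g₀) +
      g₀ * ((1 - e) * g₃ + 5 * g₂ + 4 * g₁) = 0) :
    |g₁| ≤ 8 ∧ |g₂| ≤ 200 ∧ |g₃| ≤ 20000 := by
  have hg0 : 0 < g₀ := by linarith
  have step : ∀ {y x z M N : ℝ}, y = (1 - e) * x + z → |y| ≤ M → |z| ≤ N →
      |x| ≤ 4 / 3 * (M + N) := by
    intro y x z M N hy hM hN
    have h1 : (1 - e) * |x| ≤ M + N := by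
      rw [← abs_of_nonneg (by linarith : 0 ≤ 1 - e), ← abs_mul, show (1 - e) * x = y - z by linarith]
      exact (abs_sub _ _).trans (add_le_add hM hN)
    nlinarith [abs_nonneg x]
  have quot : ∀ {y x M : ℝ}, g₀ * y = x → |x| ≤ M → |y| ≤ 2 * M := by
    intro y x M hy hM
    rw [← hy, abs_mul, abs_of_pos hg0] at hM
    nlinarith [abs_nonneg y]
  set Y₀ := (1 - e) * g₁ + g₀ with hY0d
  set Y₁ := (1 - e) * g₂ + 3 * g₁ + g₀ with hY1d
  set Y₂ := (1 - e) * g₃ + 5 * g₂ + 4 * g₁ with hY2d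
  have b0 : |g₀| ≤ 2 := by rw [abs_of_pos hg0]; exact h0'
  have bY0 : |Y₀| ≤ 8 / 3 := by
    have h1 : |g₀ * Y₀| ≤ 2 * (2 / 3) :=
      quot (x := 2 / 3) (by rw [← hY0]; ring) (by norm_num [abs_of_pos])
    have h2 := quot (y := Y₀) rfl h1
    linarith
  have b1 : |g₁| ≤ 8 := (step hY0d bY0 b0).trans (by norm_num)
  have bY1 : |Y₁| ≤ 2 * (2 * 8 * (8 / 3)) := by
    refine quot (x := -(2 * g₁ * Y₀)) (by linarith) ?_
    rw [abs_neg, abs_mul, abs_mul, abs_two]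
    gcongr
  have b2 : |g₂| ≤ 200 := by
    refine (step (z := 3 * g₁ + g₀) (N := 3 * 8 + 2) (by rw [hY1d]; ring) bY1 ?_).trans (by norm_num)
    refine (abs_add_le _ _).trans (add_le_add ?_ b0)
    rw [abs_mul, abs_of_pos (by norm_num : (0 : ℝ) < 3)]
    gcongr
  have bY2 : |Y₂| ≤ 2 * (2 * 200 * (8 / 3) + 3 * 8 * (2 * (2 * 8 * (8 / 3)))) := by
    refine quot (x := -(2 * g₂ * Y₀ + 3 * g₁ * Y₁)) (by linarith) ?_
    rw [abs_neg]
    refine (abs_add_le _ _).trans (add_le_add ?_ ?_)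
    · rw [abs_mul, abs_mul, abs_two]
      gcongr
    · rw [abs_mul, abs_mul, abs_of_pos (by norm_num : (0 : ℝ) < 3)]
      gcongr
  refine ⟨b1, b2, ?_⟩
  refine (step (z := 5 * g₂ + 4 * g₁) (N := 5 * 200 + 4 * 8) (by rw [hY2d]; ring) bY2 ?_).trans
    (by norm_num)
  refine (abs_add_le _ _).trans (add_le_add ?_ ?_)
  · rw [abs_mul, abs_of_pos (by norm_num : (0 : ℝ) < 5)]
    gcongr
  · rw [abs_mul, abs_of_pos (by norm_num : (0 : ℝ) < 4)]
    gcongr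

/-- Differentiate `slope_ode`, cancel one factor `slope u`, and differentiate again. -/
theorem slope_odes {u : ℝ} (hu : 0 < u) :
    2 * deriv slope u * ((u ^ 2 - 1) * deriv slope u + u * slope u) +
      slope u * ((u ^ 2 - 1) * deriv^[2] slope u + 3 * u * deriv slope u + slope u) = 0 ∧
    2 * deriv^[2] slope u * ((u ^ 2 - 1) * deriv slope u + u * slope u) +
      3 * deriv slope u * ((u ^ 2 - 1) * deriv^[2] slope u + 3 * u * deriv slope u + slope u) +
      slope u * ((u ^ 2 - 1) * deriv^[3] slope u + 5 * u * deriv^[2] slope u +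
        4 * deriv slope u) = 0 := by
  have d0 : ∀ v > 0, HasDerivAt slope (deriv slope v) v := fun v hv =>
    hasDerivAt_iterate_deriv_slope 0 hv
  have d1 : ∀ v > 0, HasDerivAt (deriv slope) (deriv^[2] slope v) v := fun v hv =>
    hasDerivAt_iterate_deriv_slope 1 hv
  have d2 : ∀ v > 0, HasDerivAt (deriv^[2] slope) (deriv^[3] slope v) v := fun v hv =>
    hasDerivAt_iterate_deriv_slope 2 hv
  have dq : ∀ v : ℝ, HasDerivAt (fun v : ℝ => v ^ 2 - 1) (2 * v) v := fun v => by
    simpa using (hasDerivAt_pow 2 v).sub_const 1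
  have y0 : ∀ v > 0, HasDerivAt (fun v => (v ^ 2 - 1) * deriv slope v + v * slope v)
      ((v ^ 2 - 1) * deriv^[2] slope v + 3 * v * deriv slope v + slope v) v := fun v hv => by
    refine (((dq v).mul (d1 v hv)).add ((hasDerivAt_id v).mul (d0 v hv))).congr_deriv ?_
    simp only [id]
    ring
  have y1 : ∀ v > 0, HasDerivAt
      (fun v => (v ^ 2 - 1) * deriv^[2] slope v + 3 * v * deriv slope v + slope v)
      ((v ^ 2 - 1) * deriv^[3] slope v + 5 * v * deriv^[2] slope v + 4 * deriv slope v) v :=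
    fun v hv => by
      refine ((((dq v).mul (d2 v hv)).add (((hasDerivAt_id v).const_mul 3).mul (d1 v hv))).add
        (d0 v hv)).congr_deriv ?_
      simp only [id]
      ring
  have e1 : ∀ v > 0, 2 * deriv slope v * ((v ^ 2 - 1) * deriv slope v + v * slope v) +
      slope v * ((v ^ 2 - 1) * deriv^[2] slope v + 3 * v * deriv slope v + slope v) = 0 := by
    intro v hv
    have h1 := ((d0 v hv).pow 2).mul (y0 v hv)
    have h2 : HasDerivAt (slope ^ 2 * fun v => (v ^ 2 - 1) * deriv slope v + v * slope v) 0 v := by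
      refine (hasDerivAt_const v (2 / 3 : ℝ)).congr_of_eventuallyEq ?_
      filter_upwards [Ioi_mem_nhds hv] with x hx
      exact slope_ode hx
    have h3 := h1.unique h2
    have hs := slope_pos hv
    refine mul_left_cancel₀ hs.ne' ?_
    rw [mul_zero, ← h3]
    simp only [Pi.pow_apply]
    push_cast
    ring
  refine ⟨e1 u hu, ?_⟩
  have h1 := (((d1 u hu).const_mul 2).mul (y0 u hu)).add ((d0 u hu).mul (y1 u hu))
  have h2 := (hasDerivAt_const u (0 : ℝ)).congr_of_eventuallyEq
    (Filter.eventuallyEq_of_mem (Ioi_mem_nhds hu) fun v hv => e1 v hv)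
  have h3 := h1.unique h2
  rw [← h3]
  ring

/-- The derivatives of the profile decay like those of `u ^ (2/3)`; the power `u ^ (1/3)` is
written `c` here. -/
theorem exists_slope_bound : ∃ C : ℝ, ∀ u c : ℝ, 1 ≤ u → 0 < c → c ^ 3 = u →
    ∀ k ≤ 3, c * u ^ k * |deriv^[k] slope u| ≤ C := by
  have hcomp : ∀ k : ℕ, ∃ M : ℝ, ∀ u ∈ Set.Icc (1 : ℝ) 2, |deriv^[k] slope u| ≤ M := fun k =>
    isCompact_Icc.exists_bound_of_continuousOn
      ((contDiffOn_iterate_deriv_slope k).continuousOn.mono fun u hu =>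
        lt_of_lt_of_le one_pos hu.1)
  choose M hM using hcomp
  refine ⟨20000 + ∑ k ∈ Finset.range 4, 2 * 2 ^ k * M k, fun u c hu hc hcu k hk => ?_⟩
  have hM0 : ∀ k, 0 ≤ M k := fun k => (abs_nonneg _).trans (hM k 1 (by norm_num))
  have hu0 : 0 < u := by linarith
  -- The leading coefficient `u² - 1` vanishes at the tip, so the equation controls derivatives only
  -- away from it; continuity on `[1, 2]` covers the rest.
  rcases le_total u 2 with h2 | h2
  · have hc2 : c ≤ 2 := by
      by_contra! h
      have := pow_lt_pow_left₀ h (by norm_num) (n := 3) (by norm_num)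
      norm_num at this
      linarith
    have h3 : c * u ^ k * |deriv^[k] slope u| ≤ 2 * 2 ^ k * M k := by
      have := hM k u ⟨hu, h2⟩
      gcongr
    have h4 : 2 * 2 ^ k * M k ≤ ∑ k ∈ Finset.range 4, 2 * 2 ^ k * M k :=
      Finset.single_le_sum (f := fun k => 2 * 2 ^ k * M k)
        (fun k _ => by have := hM0 k; positivity) (Finset.mem_range.2 (by omega))
    linarith
  · have h4 : 0 ≤ ∑ k ∈ Finset.range 4, 2 * 2 ^ k * M k :=
      Finset.sum_nonneg fun k _ => by have := hM0 k; positivity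
    suffices h : c * u ^ k * |deriv^[k] slope u| ≤ 20000 by linarith
    have hx := slope_pos hu0
    obtain ⟨l1, l2⟩ := slope_cube_bounds hu
    have hg : u * slope u ^ 3 = (c * slope u) ^ 3 := by rw [← hcu]; ring
    rw [hg] at l1 l2
    have hb1 : 1 / 2 ≤ c * slope u := by
      by_contra! h
      have := pow_lt_pow_left₀ h (by positivity) (n := 3) (by norm_num)
      norm_num at this
      linarith
    have hb2 : c * slope u ≤ 2 := by
      by_contra! h
      have := pow_lt_pow_left₀ h (by positivity) (n := 3) (by norm_num)
      norm_num at this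
      linarith
    obtain ⟨o1, o2⟩ := slope_odes hu0
    have o0 := slope_ode hu0
    have he : 1 / u ^ 2 ≤ 1 / 4 := by
      rw [div_le_div_iff₀ (by positivity) (by norm_num)]
      nlinarith
    obtain ⟨r1, r2, r3⟩ := scaled_ode_bounds (g₀ := c * slope u) (g₁ := c * u * deriv slope u)
      (g₂ := c * u ^ 2 * deriv^[2] slope u) (g₃ := c * u ^ 3 * deriv^[3] slope u)
      (e := 1 / u ^ 2) hb1 hb2 he
      (by
        rw [← o0]
        have : (c * slope u) ^ 2 * ((1 - 1 / u ^ 2) * (c * u * deriv slope u) + c * slope u) =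
          c ^ 3 / u * (slope u ^ 2 * ((u ^ 2 - 1) * deriv slope u + u * slope u)) := by
          field_simp
        rw [this, hcu, div_self hu0.ne', one_mul])
      (by
        have : ∀ x₀ x₁ x₂ : ℝ, 2 * (c * u * x₁) * ((1 - 1 / u ^ 2) * (c * u * x₁) + c * x₀) +
          c * x₀ * ((1 - 1 / u ^ 2) * (c * u ^ 2 * x₂) + 3 * (c * u * x₁) + c * x₀) =
          c ^ 2 * (2 * x₁ * ((u ^ 2 - 1) * x₁ + u * x₀) +
            x₀ * ((u ^ 2 - 1) * x₂ + 3 * u * x₁ + x₀)) := by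
          intro x₀ x₁ x₂
          field_simp
        rw [this, o1, mul_zero])
      (by
        have : ∀ x₀ x₁ x₂ x₃ : ℝ,
          2 * (c * u ^ 2 * x₂) * ((1 - 1 / u ^ 2) * (c * u * x₁) + c * x₀) +
          3 * (c * u * x₁) * ((1 - 1 / u ^ 2) * (c * u ^ 2 * x₂) + 3 * (c * u * x₁) + c * x₀) +
          c * x₀ * ((1 - 1 / u ^ 2) * (c * u ^ 3 * x₃) + 5 * (c * u ^ 2 * x₂) +
            4 * (c * u * x₁)) =
          c ^ 2 * u * (2 * x₂ * ((u ^ 2 - 1) * x₁ + u * x₀) +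
            3 * x₁ * ((u ^ 2 - 1) * x₂ + 3 * u * x₁ + x₀) +
            x₀ * ((u ^ 2 - 1) * x₃ + 5 * u * x₂ + 4 * x₁)) := by
          intro x₀ x₁ x₂ x₃
          field_simp
        rw [this, o2, mul_zero])
    have habs : ∀ k, c * u ^ k * |deriv^[k] slope u| = |c * u ^ k * deriv^[k] slope u| := fun k => by
      rw [abs_mul, abs_of_pos (by positivity : 0 < c * u ^ k)]
    rw [habs]
    interval_cases k
    · simp only [pow_zero, mul_one, Function.iterate_zero, id]
      rw [abs_of_pos (by positivity)]
      linarith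
    · simp only [pow_one, Function.iterate_one]
      linarith
    · linarith
    · exact r3

end Conifold

/-! ### Rescaling: the derivatives of `f_t`, uniformly in `t`. -/

namespace Conifold

/-- The successive derivatives of the profile `f_t`, extended smoothly past the tip `s = ‖t‖`. -/
noncomputable def profileJet (t : ℂ) : ℕ → ℝ → ℝ
  | 0, s => (‖t‖ ^ (1 / 3 : ℝ)) ^ 2 * unitProfile (s / ‖t‖)
  | k + 1, s => (‖t‖ ^ (1 / 3 : ℝ)) ^ 2 / ‖t‖ ^ (k + 1) * deriv^[k] slope (s / ‖t‖)

theorem hasDerivAt_profileJet {t : ℂ} (ht : t ≠ 0) (k : ℕ) {s : ℝ} (hs : 0 < s) :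
    HasDerivAt (profileJet t k) (profileJet t (k + 1) s) s := by
  have hT : 0 < ‖t‖ := norm_pos_iff.2 ht
  have hu : 0 < s / ‖t‖ := div_pos hs hT
  have h1 : HasDerivAt (fun s : ℝ => s / ‖t‖) (1 / ‖t‖) s := (hasDerivAt_id s).div_const _
  cases k with
  | zero =>
    refine (((hasDerivAt_unitProfile hu).comp s h1).const_mul _).congr_deriv ?_
    simp only [profileJet, Function.iterate_zero, id]
    ring
  | succ k =>
    refine (((hasDerivAt_iterate_deriv_slope k hu).comp s h1).const_mul _).congr_deriv ?_
    simp only [profileJet]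
    field_simp
    ring

theorem contDiffOn_profileJet {t : ℂ} (ht : t ≠ 0) (k : ℕ) :
    ContDiffOn ℝ ∞ (profileJet t k) (Set.Ioi 0) :=
  contDiffOn_infty_of_hasDerivAt isOpen_Ioi (fun k _ hs => hasDerivAt_profileJet ht k hs) k

theorem norm_rpow_third_pow_three (t : ℂ) : (‖t‖ ^ (1 / 3 : ℝ)) ^ 3 = ‖t‖ := by
  rw [← Real.rpow_natCast, ← Real.rpow_mul (norm_nonneg t)]
  norm_num

theorem profile_eq_profileJet {t : ℂ} (ht : t ≠ 0) {s : ℝ} (hs : ‖t‖ ≤ s) :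
    profile t s = profileJet t 0 s := by
  have hT : 0 < ‖t‖ := norm_pos_iff.2 ht
  rw [profile, profileJet, unitProfile_eq ((one_le_div hT).2 hs), ← Real.rpow_natCast,
    ← Real.rpow_mul (norm_nonneg t)]
  norm_num
  ring

theorem profileJet_ode {t : ℂ} (ht : t ≠ 0) {s : ℝ} (hs : 0 < s) :
    profileJet t 1 s ^ 2 * ((s ^ 2 - ‖t‖ ^ 2) * profileJet t 2 s + s * profileJet t 1 s) =
      2 / 3 := by
  have hT : 0 < ‖t‖ := norm_pos_iff.2 ht
  have h := slope_ode (div_pos hs hT)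
  have h3 := norm_rpow_third_pow_three t
  simp only [profileJet, Function.iterate_zero, Function.iterate_one, id]
  obtain ⟨u, rfl⟩ : ∃ u, s = u * ‖t‖ := ⟨s / ‖t‖, (div_mul_cancel₀ _ hT.ne').symm⟩
  rw [mul_div_cancel_right₀ _ hT.ne'] at h ⊢
  generalize ‖t‖ ^ (1 / 3 : ℝ) = θ at *
  rw [← h3] at hT ⊢
  have hθ : θ ≠ 0 := by rintro rfl; norm_num at hT
  rw [← h]
  field_simp
  ring

theorem profileJet_one_pos {t : ℂ} (ht : t ≠ 0) {s : ℝ} (hs : 0 < s) : 0 < profileJet t 1 s := by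
  have hT : 0 < ‖t‖ := norm_pos_iff.2 ht
  have := slope_pos (div_pos hs hT)
  simp only [profileJet, Function.iterate_zero, id]
  positivity

/-- The derivatives of `f_t` decay uniformly in `t` like those of `s ^ (2/3)`, where `s = σ ^ 6`. -/
theorem exists_profileJet_bound : ∃ C : ℝ, ∀ t : ℂ, t ≠ 0 → ∀ s σ : ℝ, ‖t‖ ≤ s → 0 < σ →
    σ ^ 6 = s → 1 / 2 ≤ σ ^ 2 * profileJet t 1 s ∧
      ∀ k ≤ 3, |profileJet t (k + 1) s| * σ ^ (6 * k + 2) ≤ C := by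
  obtain ⟨C, hC⟩ := exists_slope_bound
  refine ⟨C, fun t ht s σ hs hσ hσs => ?_⟩
  have hT : 0 < ‖t‖ := norm_pos_iff.2 ht
  have h3 := norm_rpow_third_pow_three t
  have hθ : 0 < ‖t‖ ^ (1 / 3 : ℝ) := Real.rpow_pos_of_pos hT _
  have hu : 1 ≤ s / ‖t‖ := (one_le_div hT).2 hs
  have hx := slope_pos (one_pos.trans_le hu)
  obtain ⟨l1, -⟩ := slope_cube_bounds hu
  have hc3 : (σ ^ 2 / ‖t‖ ^ (1 / 3 : ℝ)) ^ 3 = s / ‖t‖ := by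
    rw [div_pow, h3, ← hσs]; ring
  have hb := hC (s / ‖t‖) (σ ^ 2 / ‖t‖ ^ (1 / 3 : ℝ)) hu (by positivity) hc3
  -- The weighted derivatives are scale invariant: they equal those of the unit slope at `u = s /
  -- ‖t‖`, with cube root `c = σ² / ‖t‖^(1/3)`. This is where the dependence on `t` disappears.
  have key : ∀ k, σ ^ (6 * k + 2) * profileJet t (k + 1) s =
      σ ^ 2 / ‖t‖ ^ (1 / 3 : ℝ) * (s / ‖t‖) ^ k * deriv^[k] slope (s / ‖t‖) := by
    intro k
    simp only [profileJet]
    generalize deriv^[k] slope (s / ‖t‖) = X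
    rw [pow_add, pow_mul, hσs, pow_succ ‖t‖ k, div_pow]
    generalize ‖t‖ ^ (1 / 3 : ℝ) = θ at *
    have h4 : ‖t‖ ^ k * ‖t‖ = ‖t‖ ^ k * θ ^ 3 := by rw [h3]
    rw [h4]
    field_simp
  constructor
  · have k0 := key 0
    simp only [mul_zero, zero_add, pow_zero, mul_one, Function.iterate_zero, id] at k0
    rw [k0]
    have hg : s / ‖t‖ * slope (s / ‖t‖) ^ 3 =
        (σ ^ 2 / ‖t‖ ^ (1 / 3 : ℝ) * slope (s / ‖t‖)) ^ 3 := by rw [← hc3]; ring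
    rw [hg] at l1
    by_contra! h
    have := pow_lt_pow_left₀ h (by positivity) (n := 3) (by norm_num)
    norm_num at this
    linarith
  · intro k hk
    rw [mul_comm, ← abs_of_pos (by positivity : 0 < σ ^ (6 * k + 2)), ← abs_mul, key, abs_mul,
      abs_of_pos]
    · exact hb k hk
    · have : 0 < s := hT.trans_le hs
      positivity

end Conifold

/-! ### Wirtinger calculus. -/

namespace Conifold

/-- `h` is real differentiable at `z` with `∂h/∂zᵢ = aᵢ` and `∂h/∂z̄ᵢ = bᵢ`. -/
structure HasWirtingerAt (h : (Fin 3 → ℂ) → ℂ) (a b : Fin 3 → ℂ) (z : Fin 3 → ℂ) : Prop where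
  differentiableAt : DifferentiableAt ℝ h z
  wirtinger_eq : ∀ i, wirtinger i h z = a i
  wirtingerBar_eq : ∀ i, wirtingerBar i h z = b i

namespace HasWirtingerAt

variable {h h' : (Fin 3 → ℂ) → ℂ} {a b a' b' : Fin 3 → ℂ} {z : Fin 3 → ℂ}

theorem congr_of_eventuallyEq (H : HasWirtingerAt h a b z) (e : h' =ᶠ[nhds z] h) :
    HasWirtingerAt h' a b z := by
  refine ⟨H.differentiableAt.congr_of_eventuallyEq e, fun i => ?_, fun i => ?_⟩
  · rw [← H.wirtinger_eq i, wirtinger, wirtinger, e.fderiv_eq]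
  · rw [← H.wirtingerBar_eq i, wirtingerBar, wirtingerBar, e.fderiv_eq]

theorem congr_coeff (H : HasWirtingerAt h a b z) (ha : ∀ i, a i = a' i) (hb : ∀ i, b i = b' i) :
    HasWirtingerAt h a' b' z :=
  ⟨H.differentiableAt, fun i => (H.wirtinger_eq i).trans (ha i),
    fun i => (H.wirtingerBar_eq i).trans (hb i)⟩

theorem add (H : HasWirtingerAt h a b z) (H' : HasWirtingerAt h' a' b' z) :
    HasWirtingerAt (fun x => h x + h' x) (fun i => a i + a' i) (fun i => b i + b' i) z := by
  have hd := (H.differentiableAt.hasFDerivAt.add H'.differentiableAt.hasFDerivAt)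
  refine ⟨hd.differentiableAt, fun i => ?_, fun i => ?_⟩
  · rw [← H.wirtinger_eq i, ← H'.wirtinger_eq i, wirtinger, wirtinger, wirtinger]
    erw [hd.fderiv]
    simp only [add_apply]
    ring
  · rw [← H.wirtingerBar_eq i, ← H'.wirtingerBar_eq i, wirtingerBar, wirtingerBar, wirtingerBar]
    erw [hd.fderiv]
    simp only [add_apply]
    ring

theorem mul (H : HasWirtingerAt h a b z) (H' : HasWirtingerAt h' a' b' z) :
    HasWirtingerAt (fun x => h x * h' x) (fun i => a i * h' z + h z * a' i)
      (fun i => b i * h' z + h z * b' i) z := by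
  have hd := (H.differentiableAt.hasFDerivAt.mul H'.differentiableAt.hasFDerivAt)
  refine ⟨hd.differentiableAt, fun i => ?_, fun i => ?_⟩
  · rw [← H.wirtinger_eq i, ← H'.wirtinger_eq i, wirtinger, wirtinger, wirtinger]
    erw [hd.fderiv]
    simp only [add_apply, smul_apply, smul_eq_mul]
    ring
  · rw [← H.wirtingerBar_eq i, ← H'.wirtingerBar_eq i, wirtingerBar, wirtingerBar, wirtingerBar]
    erw [hd.fderiv]
    simp only [add_apply, smul_apply, smul_eq_mul]
    ring

theorem const (c : ℂ) (z : Fin 3 → ℂ) : HasWirtingerAt (fun _ => c) (fun _ => 0) (fun _ => 0) z :=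
  ⟨differentiableAt_const c, fun i => by simp [wirtinger], fun i => by simp [wirtingerBar]⟩

theorem sum {ι : Type*} (s : Finset ι) {h : ι → (Fin 3 → ℂ) → ℂ} {a b : ι → Fin 3 → ℂ}
    (H : ∀ n ∈ s, HasWirtingerAt (h n) (a n) (b n) z) :
    HasWirtingerAt (fun x => ∑ n ∈ s, h n x) (fun i => ∑ n ∈ s, a n i) (fun i => ∑ n ∈ s, b n i)
      z := by
  classical
  induction s using Finset.induction_on with
  | empty => simpa using const 0 z
  | insert n s hn ih =>
    simp only [Finset.sum_insert hn]
    exact (H n (Finset.mem_insert_self _ _)).add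
      (ih fun m hm => H m (Finset.mem_insert_of_mem hm))

theorem conj (H : HasWirtingerAt h a b z) :
    HasWirtingerAt (fun x => star (h x)) (fun i => star (b i)) (fun i => star (a i)) z := by
  have hd := H.differentiableAt.hasFDerivAt.star
  refine ⟨hd.differentiableAt, fun i => ?_, fun i => ?_⟩
  · rw [← H.wirtingerBar_eq i, wirtinger, wirtingerBar]
    erw [hd.fderiv]
    simp [sub_eq_add_neg]
  · rw [← H.wirtinger_eq i, wirtinger, wirtingerBar]
    erw [hd.fderiv]
    simp [sub_eq_add_neg]

/-- Cauchy–Riemann: the real derivative is complex linear, so the direction `I` contributes `I`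
times the direction `1`. -/
theorem of_differentiableAt (H : DifferentiableAt ℂ h z) :
    HasWirtingerAt h (fun i => fderiv ℂ h z (Pi.single i 1)) (fun _ => 0) z := by
  have hd := H.hasFDerivAt.restrictScalars ℝ
  have hI : ∀ i : Fin 3, (Pi.single i I : Fin 3 → ℂ) = I • Pi.single i 1 := fun i => by
    rw [← Pi.single_smul, smul_eq_mul, mul_one]
  refine ⟨hd.differentiableAt, fun i => ?_, fun i => ?_⟩
  · rw [wirtinger, hd.fderiv, hI]
    simp only [ContinuousLinearMap.coe_restrictScalars', map_smul, smul_eq_mul]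
    linear_combination (-1 / 2 * fderiv ℂ h z (Pi.single i 1)) * I_sq
  · rw [wirtingerBar, hd.fderiv, hI]
    simp only [ContinuousLinearMap.coe_restrictScalars', map_smul, smul_eq_mul]
    linear_combination (1 / 2 * fderiv ℂ h z (Pi.single i 1)) * I_sq

theorem comp_real {ρ : (Fin 3 → ℂ) → ℝ} (H : HasWirtingerAt (fun x => (ρ x : ℂ)) a b z)
    {g : ℝ → ℝ} {g' : ℝ} (hg : HasDerivAt g g' (ρ z)) :
    HasWirtingerAt (fun x => (g (ρ x) : ℂ)) (fun i => g' * a i) (fun i => g' * b i) z := by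
  have hρ : DifferentiableAt ℝ ρ z := by
    have := Complex.reCLM.differentiableAt.comp z H.differentiableAt
    simpa [Function.comp_def] using this
  have h1 : fderiv ℝ (fun x => (ρ x : ℂ)) z = Complex.ofRealCLM.comp (fderiv ℝ ρ z) :=
    (Complex.ofRealCLM.hasFDerivAt.comp z hρ.hasFDerivAt).fderiv
  have h2 : HasFDerivAt (fun x => (g (ρ x) : ℂ)) (Complex.ofRealCLM.comp (g' • fderiv ℝ ρ z)) z :=
    Complex.ofRealCLM.hasFDerivAt.comp z (hg.comp_hasFDerivAt z hρ.hasFDerivAt)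
  refine ⟨h2.differentiableAt, fun i => ?_, fun i => ?_⟩
  · rw [← H.wirtinger_eq i, wirtinger, wirtinger, h2.fderiv, h1]
    simp
    ring
  · rw [← H.wirtingerBar_eq i, wirtingerBar, wirtingerBar, h2.fderiv, h1]
    simp
    ring

end HasWirtingerAt

/-- The standard Hermitian pairing on `ℂ⁴`. -/
def pairing (x y : Fin 4 → ℂ) : ℂ := ∑ m, x m * star (y m)

/-- The pairing is holomorphic in `A` and antiholomorphic in `B`, so each operator differentiates
only one factor. -/
theorem HasWirtingerAt.pairing {A B : (Fin 3 → ℂ) → Fin 4 → ℂ} {z : Fin 3 → ℂ}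
    (hA : DifferentiableAt ℂ A z) (hB : DifferentiableAt ℂ B z) :
    HasWirtingerAt (fun x => pairing (A x) (B x))
      (fun k => Conifold.pairing (fderiv ℂ A z (Pi.single k 1)) (B z))
      (fun k => Conifold.pairing (A z) (fderiv ℂ B z (Pi.single k 1))) z := by
  have hA' := fun m => HasWirtingerAt.of_differentiableAt (differentiableAt_pi.1 hA m)
  have hB' := fun m => (HasWirtingerAt.of_differentiableAt (differentiableAt_pi.1 hB m)).conj
  refine (HasWirtingerAt.sum Finset.univ fun m _ => (hA' m).mul (hB' m)).congr_coeff
    (fun i => ?_) (fun i => ?_)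
  · simp only [star_zero, mul_zero, add_zero, Conifold.pairing]
    simp [fderiv_apply hA]
  · simp only [zero_mul, zero_add, Conifold.pairing]
    simp [fderiv_apply hB]

end Conifold

/-! ### Pulling back a radial potential by a holomorphic map. -/

namespace Conifold

theorem pairing_self (w : Fin 4 → ℂ) : pairing w w = (radiusSq w : ℂ) := by
  simp only [pairing, radiusSq, ofReal_sum, ofReal_pow, starRingEnd_apply, ← mul_conj']

theorem star_pairing (x y : Fin 4 → ℂ) : star (pairing x y) = pairing y x := by
  simp [pairing, mul_comm]

theorem pairing_add_left (x x' y : Fin 4 → ℂ) :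
    pairing (x + x') y = pairing x y + pairing x' y := by
  simp [pairing, add_mul, Finset.sum_add_distrib]

theorem pairing_smul_left (c : ℂ) (x y : Fin 4 → ℂ) : pairing (c • x) y = c * pairing x y := by
  simp [pairing, Finset.mul_sum, mul_assoc]

theorem pairing_add_right (x y y' : Fin 4 → ℂ) :
    pairing x (y + y') = pairing x y + pairing x y' := by
  simp [pairing, mul_add, Finset.sum_add_distrib]

theorem pairing_smul_right (c : ℂ) (x y : Fin 4 → ℂ) :
    pairing x (c • y) = star c * pairing x y := by
  simp only [pairing, Finset.mul_sum, Pi.smul_apply, smul_eq_mul, star_mul']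
  exact Finset.sum_congr rfl fun m _ => by ring

theorem radiusSq_pos {w : Fin 4 → ℂ} (hw : w ≠ 0) : 0 < radiusSq w := by
  obtain ⟨m, hm⟩ := Function.ne_iff.1 hw
  exact Finset.sum_pos' (fun _ _ => by positivity)
    ⟨m, Finset.mem_univ m, pow_pos (norm_pos_iff.2 hm) 2⟩

/-- The value of `√-1 ∂∂̄ f(r²)` on `ℂ⁴`, at the point `w`, on a pair of vectors; `c₁`, `c₂` stand
for the first two derivatives of `f` at `r²`. -/
noncomputable def metricForm (c₁ c₂ : ℝ) (w x y : Fin 4 → ℂ) : ℂ :=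
  c₁ * pairing x y + c₂ * (pairing x w * pairing w y)

/-- The derivative of `metricForm` in the direction `z`, with `x` and `y` constant. -/
noncomputable def cubicForm (c₂ c₃ : ℝ) (w x z y : Fin 4 → ℂ) : ℂ :=
  c₂ * (pairing z w * pairing x y + pairing x w * pairing z y) +
    c₃ * (pairing x w * pairing z w * pairing w y)

/-- The second derivative of `metricForm` in the directions `z` and `v̄`, with `x` and `y`
constant. -/
noncomputable def quarticForm (c₂ c₃ c₄ : ℝ) (w x y z v : Fin 4 → ℂ) : ℂ :=
  c₂ * (pairing z v * pairing x y + pairing x v * pairing z y) +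
    c₃ * (pairing z w * pairing x y * pairing w v + pairing x w * pairing z y * pairing w v +
      pairing x v * pairing z w * pairing w y + pairing x w * pairing z v * pairing w y) +
    c₄ * (pairing x w * pairing z w * pairing w y * pairing w v)

/-- The complex partial derivative `∂W/∂zᵢ`. -/
noncomputable def partialDeriv (i : Fin 3) (W : (Fin 3 → ℂ) → Fin 4 → ℂ) (z : Fin 3 → ℂ) :
    Fin 4 → ℂ :=
  fderiv ℂ W z (Pi.single i 1)

section Pullback

variable {U : Set (Fin 3 → ℂ)} (hU : IsOpen U) {W : (Fin 3 → ℂ) → Fin 4 → ℂ}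
  (hW : DifferentiableOn ℂ W U) (hW0 : ∀ z ∈ U, W z ≠ 0) {f : ℕ → ℝ → ℝ}
  (hf : ∀ k, ∀ s > 0, HasDerivAt (f k) (f (k + 1) s) s)
  {F : (Fin 3 → ℂ) → ℝ} (hF : ∀ z ∈ U, F z = f 0 (radiusSq (W z)))

include hU hW in
theorem differentiableOn_partialDeriv (i : Fin 3) : DifferentiableOn ℂ (partialDeriv i W) U :=
  differentiableOn_fderiv_apply_complex hU hW _

include hU hW hW0 hf in
theorem hasWirtingerAt_radial {z : Fin 3 → ℂ} (hz : z ∈ U) (k : ℕ) :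
    HasWirtingerAt (fun x => (f k (radiusSq (W x)) : ℂ))
      (fun i => f (k + 1) (radiusSq (W z)) * pairing (partialDeriv i W z) (W z))
      (fun i => f (k + 1) (radiusSq (W z)) * pairing (W z) (partialDeriv i W z)) z := by
  have hd := hW.differentiableAt (hU.mem_nhds hz)
  have h1 : HasWirtingerAt (fun x => (radiusSq (W x) : ℂ))
      (fun i => pairing (partialDeriv i W z) (W z))
      (fun i => pairing (W z) (partialDeriv i W z)) z := by
    simp only [← pairing_self]
    exact HasWirtingerAt.pairing hd hd
  exact h1.comp_real (hf k _ (radiusSq_pos (hW0 z hz)))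

include hU hW hW0 hf hF in
-- No second derivative of `W` appears, because mixed derivatives of holomorphic maps vanish.
theorem kahlerMatrix_eq_metricForm {z : Fin 3 → ℂ} (hz : z ∈ U) (i j : Fin 3) :
    kahlerMatrix F z i j = metricForm (f 1 (radiusSq (W z))) (f 2 (radiusSq (W z))) (W z)
      (partialDeriv i W z) (partialDeriv j W z) := by
  have h0 : (wirtingerBar j fun x => (F x : ℂ)) =ᶠ[nhds z]
      fun x => f 1 (radiusSq (W x)) * pairing (W x) (partialDeriv j W x) := by
    filter_upwards [hU.mem_nhds hz] with x hx
    have h1 := hasWirtingerAt_radial hU hW hW0 hf hx 0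
    refine (h1.congr_of_eventuallyEq ?_).wirtingerBar_eq j
    filter_upwards [hU.mem_nhds hx] with y hy
    rw [hF y hy]
  have hd := hW.differentiableAt (hU.mem_nhds hz)
  have hdj := (differentiableOn_partialDeriv hU hW j).differentiableAt (hU.mem_nhds hz)
  have h2 := (hasWirtingerAt_radial hU hW hW0 hf hz 1).mul (HasWirtingerAt.pairing hd hdj)
  have h3 := (h2.congr_of_eventuallyEq h0).wirtinger_eq i
  rw [kahlerMatrix, Matrix.of_apply, h3, metricForm]
  simp only [partialDeriv]
  ring

include hU hW hW0 hf hF in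
theorem hasWirtingerAt_kahlerMatrix {z : Fin 3 → ℂ} (hz : z ∈ U) (i j : Fin 3) :
    HasWirtingerAt (fun x => kahlerMatrix F x i j)
      (fun k => metricForm (f 1 (radiusSq (W z))) (f 2 (radiusSq (W z))) (W z)
          (partialDeriv k (partialDeriv i W) z) (partialDeriv j W z) +
        cubicForm (f 2 (radiusSq (W z))) (f 3 (radiusSq (W z))) (W z)
          (partialDeriv i W z) (partialDeriv k W z) (partialDeriv j W z))
      (fun l => metricForm (f 1 (radiusSq (W z))) (f 2 (radiusSq (W z))) (W z)
          (partialDeriv i W z) (partialDeriv l (partialDeriv j W) z) +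
        star (cubicForm (f 2 (radiusSq (W z))) (f 3 (radiusSq (W z))) (W z)
          (partialDeriv j W z) (partialDeriv l W z) (partialDeriv i W z))) z := by
  have hd := hW.differentiableAt (hU.mem_nhds hz)
  have hdi := (differentiableOn_partialDeriv hU hW i).differentiableAt (hU.mem_nhds hz)
  have hdj := (differentiableOn_partialDeriv hU hW j).differentiableAt (hU.mem_nhds hz)
  have hr := hasWirtingerAt_radial hU hW hW0 hf hz
  have h1 := ((hr 1).mul (HasWirtingerAt.pairing hdi hdj)).add
    ((hr 2).mul ((HasWirtingerAt.pairing hdi hd).mul (HasWirtingerAt.pairing hd hdj)))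
  refine (h1.congr_of_eventuallyEq ?_).congr_coeff (fun k => ?_) fun l => ?_
  · filter_upwards [hU.mem_nhds hz] with x hx
    rw [kahlerMatrix_eq_metricForm hU hW hW0 hf hF hx, metricForm]
  · simp only [metricForm, cubicForm, partialDeriv]
    ring
  · simp only [metricForm, cubicForm, partialDeriv, star_add, star_mul', star_pairing]
    simp only [RCLike.star_def, conj_ofReal]
    ring

include hU hW hW0 hf hF in
-- Leibniz rule, sorted by whether each derivative falls on a first derivative of `W` or on the
-- ambient Hermitian form.
theorem wirtinger_wirtingerBar_kahlerMatrix {z : Fin 3 → ℂ} (hz : z ∈ U) (i j k l : Fin 3) :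
    wirtinger k (wirtingerBar l fun x => kahlerMatrix F x i j) z =
      metricForm (f 1 (radiusSq (W z))) (f 2 (radiusSq (W z))) (W z)
        (partialDeriv k (partialDeriv i W) z) (partialDeriv l (partialDeriv j W) z) +
      cubicForm (f 2 (radiusSq (W z))) (f 3 (radiusSq (W z))) (W z)
        (partialDeriv i W z) (partialDeriv k W z) (partialDeriv l (partialDeriv j W) z) +
      star (cubicForm (f 2 (radiusSq (W z))) (f 3 (radiusSq (W z))) (W z)
        (partialDeriv j W z) (partialDeriv l W z) (partialDeriv k (partialDeriv i W) z)) +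
      quarticForm (f 2 (radiusSq (W z))) (f 3 (radiusSq (W z))) (f 4 (radiusSq (W z))) (W z)
        (partialDeriv i W z) (partialDeriv j W z) (partialDeriv k W z) (partialDeriv l W z) := by
  have hd := hW.differentiableAt (hU.mem_nhds hz)
  have hD := fun i => (differentiableOn_partialDeriv hU hW i).differentiableAt (hU.mem_nhds hz)
  have hdjl := (differentiableOn_partialDeriv hU (differentiableOn_partialDeriv hU hW j)
    l).differentiableAt (hU.mem_nhds hz)
  have hr := hasWirtingerAt_radial hU hW hW0 hf hz
  have p : ∀ {A B : (Fin 3 → ℂ) → Fin 4 → ℂ}, DifferentiableAt ℂ A z → DifferentiableAt ℂ B z →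
    _ := fun hA hB => HasWirtingerAt.pairing hA hB
  have h1 := (((hr 1).mul (p (hD i) hdjl)).add ((hr 2).mul ((p (hD i) hd).mul (p hd hdjl)))).add
    (((hr 2).mul (((p hd (hD l)).mul (p (hD i) (hD j))).add
      ((p hd (hD j)).mul (p (hD i) (hD l))))).add
      ((hr 3).mul (((p hd (hD j)).mul (p hd (hD l))).mul (p (hD i) hd))))
  have h2 := (h1.congr_of_eventuallyEq (h' := wirtingerBar l fun x => kahlerMatrix F x i j)
    ?_).wirtinger_eq k
  · rw [h2]
    simp only [metricForm, cubicForm, quarticForm, partialDeriv, star_add, star_mul', star_pairing]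
    simp only [RCLike.star_def, conj_ofReal]
    ring
  · filter_upwards [hU.mem_nhds hz] with x hx
    rw [(hasWirtingerAt_kahlerMatrix hU hW hW0 hf hF hx i j).wirtingerBar_eq l]
    simp only [metricForm, cubicForm, star_add, star_mul', star_pairing]
    simp only [RCLike.star_def, conj_ofReal]

end Pullback

end Conifold

/-! ### Pointwise algebra and estimates on the tangent space. -/

namespace Conifold

theorem metricForm_add_left (c₁ c₂ : ℝ) (w x x' y : Fin 4 → ℂ) :
    metricForm c₁ c₂ w (x + x') y = metricForm c₁ c₂ w x y + metricForm c₁ c₂ w x' y := by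
  simp only [metricForm, pairing_add_left]; ring

theorem metricForm_smul_left (c₁ c₂ : ℝ) (c : ℂ) (w x y : Fin 4 → ℂ) :
    metricForm c₁ c₂ w (c • x) y = c * metricForm c₁ c₂ w x y := by
  simp only [metricForm, pairing_smul_left]; ring

theorem metricForm_add_right (c₁ c₂ : ℝ) (w x y y' : Fin 4 → ℂ) :
    metricForm c₁ c₂ w x (y + y') = metricForm c₁ c₂ w x y + metricForm c₁ c₂ w x y' := by
  simp only [metricForm, pairing_add_right]; ring

theorem metricForm_smul_right (c₁ c₂ : ℝ) (c : ℂ) (w x y : Fin 4 → ℂ) :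
    metricForm c₁ c₂ w x (c • y) = star c * metricForm c₁ c₂ w x y := by
  simp only [metricForm, pairing_smul_right]; ring

theorem star_metricForm (c₁ c₂ : ℝ) (w x y : Fin 4 → ℂ) :
    star (metricForm c₁ c₂ w x y) = metricForm c₁ c₂ w y x := by
  simp only [metricForm, star_add, star_mul', star_pairing]
  simp only [RCLike.star_def, conj_ofReal]
  ring

theorem cubicForm_add_right (c₂ c₃ : ℝ) (w x z y y' : Fin 4 → ℂ) :
    cubicForm c₂ c₃ w x z (y + y') = cubicForm c₂ c₃ w x z y + cubicForm c₂ c₃ w x z y' := by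
  simp only [cubicForm, pairing_add_right]; ring

theorem cubicForm_smul_right (c₂ c₃ : ℝ) (c : ℂ) (w x z y : Fin 4 → ℂ) :
    cubicForm c₂ c₃ w x z (c • y) = star c * cubicForm c₂ c₃ w x z y := by
  simp only [cubicForm, pairing_smul_right]; ring

/-- The curvature in terms of the first derivatives `a` and the second derivatives `x`, `y` of a
parametrisation that is orthonormal at a point. -/
noncomputable def curvatureForm (c₁ c₂ c₃ c₄ : ℝ) (w : Fin 4 → ℂ) (a : Fin 3 → Fin 4 → ℂ)
    (i j k l : Fin 3) (x y : Fin 4 → ℂ) : ℂ :=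
  -(metricForm c₁ c₂ w x y + cubicForm c₂ c₃ w (a i) (a k) y +
      star (cubicForm c₂ c₃ w (a j) (a l) x) + quarticForm c₂ c₃ c₄ w (a i) (a j) (a k) (a l)) +
    ∑ p, (metricForm c₁ c₂ w x (a p) + cubicForm c₂ c₃ w (a i) (a k) (a p)) *
      (metricForm c₁ c₂ w (a p) y + star (cubicForm c₂ c₃ w (a j) (a l) (a p)))

section Invariance

variable {c₁ c₂ : ℝ} {w : Fin 4 → ℂ} {a : Fin 3 → Fin 4 → ℂ}
  (ha : ∀ p q, metricForm c₁ c₂ w (a p) (a q) = if p = q then 1 else 0)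

include ha

/-- A tangential change of `x` reflects a quadratic change of coordinates. By orthonormality it
alters a single summand of the sum over `p`, and this cancels the change in the second derivative of
the metric. -/
theorem curvatureForm_add_smul_left (c₃ c₄ : ℝ) (i j k l : Fin 3) (x y : Fin 4 → ℂ) (c : ℂ)
    (q : Fin 3) : curvatureForm c₁ c₂ c₃ c₄ w a i j k l (x + c • a q) y =
      curvatureForm c₁ c₂ c₃ c₄ w a i j k l x y := by
  have h : ∀ p, (metricForm c₁ c₂ w (x + c • a q) (a p) + cubicForm c₂ c₃ w (a i) (a k) (a p)) *
      (metricForm c₁ c₂ w (a p) y + star (cubicForm c₂ c₃ w (a j) (a l) (a p))) =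
      (metricForm c₁ c₂ w x (a p) + cubicForm c₂ c₃ w (a i) (a k) (a p)) *
      (metricForm c₁ c₂ w (a p) y + star (cubicForm c₂ c₃ w (a j) (a l) (a p))) +
      if q = p then c * (metricForm c₁ c₂ w (a p) y + star (cubicForm c₂ c₃ w (a j) (a l) (a p)))
      else 0 := by
    intro p
    rw [metricForm_add_left, metricForm_smul_left, ha]
    split_ifs <;> ring
  simp only [curvatureForm]
  rw [Finset.sum_congr rfl fun p _ => h p, Finset.sum_add_distrib, Finset.sum_ite_eq,
    if_pos (Finset.mem_univ _), metricForm_add_left, metricForm_smul_left, cubicForm_add_right,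
    cubicForm_smul_right, star_add, star_mul', star_star]
  ring

theorem curvatureForm_add_smul_right (c₃ c₄ : ℝ) (i j k l : Fin 3) (x y : Fin 4 → ℂ) (c : ℂ)
    (q : Fin 3) : curvatureForm c₁ c₂ c₃ c₄ w a i j k l x (y + c • a q) =
      curvatureForm c₁ c₂ c₃ c₄ w a i j k l x y := by
  have h : ∀ p, (metricForm c₁ c₂ w x (a p) + cubicForm c₂ c₃ w (a i) (a k) (a p)) *
      (metricForm c₁ c₂ w (a p) (y + c • a q) + star (cubicForm c₂ c₃ w (a j) (a l) (a p))) =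
      (metricForm c₁ c₂ w x (a p) + cubicForm c₂ c₃ w (a i) (a k) (a p)) *
      (metricForm c₁ c₂ w (a p) y + star (cubicForm c₂ c₃ w (a j) (a l) (a p))) +
      if p = q then star c * (metricForm c₁ c₂ w x (a p) + cubicForm c₂ c₃ w (a i) (a k) (a p))
      else 0 := by
    intro p
    rw [metricForm_add_right, metricForm_smul_right, ha]
    split_ifs <;> ring
  simp only [curvatureForm]
  rw [Finset.sum_congr rfl fun p _ => h p, Finset.sum_add_distrib, Finset.sum_ite_eq',
    if_pos (Finset.mem_univ _), metricForm_add_right, metricForm_smul_right, cubicForm_add_right,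
    cubicForm_smul_right]
  ring

theorem curvatureForm_add_sum (c₃ c₄ : ℝ) (i j k l : Fin 3) (x y : Fin 4 → ℂ) (c d : Fin 3 → ℂ) :
    curvatureForm c₁ c₂ c₃ c₄ w a i j k l (x + ∑ p, c p • a p) (y + ∑ p, d p • a p) =
      curvatureForm c₁ c₂ c₃ c₄ w a i j k l x y := by
  simp only [Fin.sum_univ_three, ← add_assoc, curvatureForm_add_smul_left ha,
    curvatureForm_add_smul_right ha]

theorem linearIndependent_of_orthonormal : LinearIndependent ℂ a := by
  rw [Fintype.linearIndependent_iff]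
  intro c hc q
  have h : ∀ s : Finset (Fin 3), metricForm c₁ c₂ w (∑ p ∈ s, c p • a p) (a q) =
      ∑ p ∈ s, c p * metricForm c₁ c₂ w (a p) (a q) := by
    intro s
    induction s using Finset.induction_on with
    | empty => simp [metricForm, pairing]
    | insert p s hp ih =>
      rw [Finset.sum_insert hp, Finset.sum_insert hp, metricForm_add_left, metricForm_smul_left, ih]
  have h1 := h Finset.univ
  have h0 : metricForm c₁ c₂ w 0 (a q) = 0 := by simp [metricForm, pairing]
  simp only [hc, h0, ha, mul_ite, mul_one, mul_zero, Finset.sum_ite_eq', Finset.mem_univ,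
    if_true] at h1
  exact h1.symm

end Invariance

/-- Three independent vectors span the tangent space of the quadric at `w`. -/
theorem exists_eq_sum_of_tangent {w : Fin 4 → ℂ} (hw : w ≠ 0) {a : Fin 3 → Fin 4 → ℂ}
    (ha : LinearIndependent ℂ a) (haw : ∀ p, ∑ m, w m * a p m = 0) {v : Fin 4 → ℂ}
    (hv : ∑ m, w m * v m = 0) : ∃ c : Fin 3 → ℂ, v = ∑ p, c p • a p := by
  let φ : (Fin 4 → ℂ) →ₗ[ℂ] ℂ := ∑ m, w m • LinearMap.proj m
  have hφ : ∀ x, φ x = ∑ m, w m * x m := fun x => by simp [φ]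
  have hφ0 : φ ≠ 0 := by
    obtain ⟨m, hm⟩ := Function.ne_iff.1 hw
    intro h
    have h1 := hφ (Pi.single m 1)
    rw [h] at h1
    simp [Pi.single_apply] at h1
    exact hm (by simpa using h1.symm)
  have hle : Submodule.span ℂ (Set.range a) ≤ LinearMap.ker φ := by
    rw [Submodule.span_le]
    rintro _ ⟨p, rfl⟩
    exact (hφ _).trans (haw p)
  have hker : Module.finrank ℂ (LinearMap.ker φ) = 3 := by
    have h1 := Module.Dual.finrank_ker_add_one_of_ne_zero (f := φ) hφ0
    rw [Module.finrank_fin_fun] at h1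
    omega
  have heq := Submodule.eq_of_le_of_finrank_eq hle
    ((finrank_span_eq_card ha).trans (by rw [hker]; simp))
  have hmem : v ∈ Submodule.span ℂ (Set.range a) := by
    rw [heq]
    exact (hφ v).trans hv
  obtain ⟨c, hc⟩ := (Submodule.mem_span_range_iff_exists_fun ℂ).1 hmem
  exact ⟨c, hc.symm⟩

/-- The norm on `Fin 4 → ℂ` is the sup norm, hence the factor `4`. -/
theorem norm_pairing_le {x y : Fin 4 → ℂ} {X Y : ℝ} (hx : ‖x‖ ≤ X) (hy : ‖y‖ ≤ Y) :
    ‖pairing x y‖ ≤ 4 * (X * Y) := by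
  have hX : 0 ≤ X := (norm_nonneg x).trans hx
  refine (norm_sum_le _ _).trans ((Finset.sum_le_sum (g := fun _ => X * Y) fun m _ => ?_).trans ?_)
  · rw [norm_mul, norm_star]
    exact mul_le_mul ((norm_le_pi_norm x m).trans hx) ((norm_le_pi_norm y m).trans hy)
      (norm_nonneg _) hX
  · simp

section Bounds

variable {c₁ c₂ c₃ c₄ C σ : ℝ} {w : Fin 4 → ℂ} (hσ : 0 < σ) (hw : ‖w‖ ≤ σ ^ 3)
  (h₁ : |c₁| ≤ C / σ ^ 2) (h₂ : |c₂| ≤ C / σ ^ 8) (h₃ : |c₃| ≤ C / σ ^ 14)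
  (h₄ : |c₄| ≤ C / σ ^ 20)

theorem norm_mul_le_mul {x y : ℂ} {X Y : ℝ} (hx : ‖x‖ ≤ X) (hy : ‖y‖ ≤ Y) : ‖x * y‖ ≤ X * Y := by
  rw [norm_mul]
  exact mul_le_mul hx hy (norm_nonneg _) ((norm_nonneg x).trans hx)

theorem norm_ofReal_le {c X : ℝ} (h : |c| ≤ X) : ‖(c : ℂ)‖ ≤ X := by
  rwa [norm_real, Real.norm_eq_abs]

include hσ hw h₁ h₂ in
theorem norm_metricForm_le {x y : Fin 4 → ℂ} {X Y : ℝ} (hx : ‖x‖ ≤ X) (hy : ‖y‖ ≤ Y) :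
    ‖metricForm c₁ c₂ w x y‖ ≤ 20 * C * (X * Y) / σ ^ 2 := by
  refine (norm_add_le_of_le (norm_mul_le_mul (norm_ofReal_le h₁) (norm_pairing_le hx hy))
    (norm_mul_le_mul (norm_ofReal_le h₂) (norm_mul_le_mul (norm_pairing_le hx hw)
      (norm_pairing_le hw hy)))).trans_eq ?_
  field_simp
  ring

include hσ hw h₂ h₃ in
theorem norm_cubicForm_le {x y z : Fin 4 → ℂ} {X Y Z : ℝ} (hx : ‖x‖ ≤ X) (hy : ‖y‖ ≤ Y)
    (hz : ‖z‖ ≤ Z) : ‖cubicForm c₂ c₃ w x z y‖ ≤ 96 * C * (X * Y * Z) / σ ^ 5 := by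
  have p : ∀ {x y : Fin 4 → ℂ} {X Y : ℝ}, ‖x‖ ≤ X → ‖y‖ ≤ Y → ‖pairing x y‖ ≤ 4 * (X * Y) :=
    norm_pairing_le
  refine (norm_add_le_of_le (norm_mul_le_mul (norm_ofReal_le h₂) (norm_add_le_of_le
      (norm_mul_le_mul (p hz hw) (p hx hy)) (norm_mul_le_mul (p hx hw) (p hz hy))))
    (norm_mul_le_mul (norm_ofReal_le h₃) (norm_mul_le_mul (norm_mul_le_mul (p hx hw) (p hz hw))
      (p hw hy)))).trans_eq ?_
  field_simp
  ring

include hσ hw h₂ h₃ h₄ in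
theorem norm_quarticForm_le {x y z v : Fin 4 → ℂ} {X Y Z V : ℝ} (hx : ‖x‖ ≤ X) (hy : ‖y‖ ≤ Y)
    (hz : ‖z‖ ≤ Z) (hv : ‖v‖ ≤ V) :
    ‖quarticForm c₂ c₃ c₄ w x y z v‖ ≤ 544 * C * (X * Y * Z * V) / σ ^ 8 := by
  have p : ∀ {x y : Fin 4 → ℂ} {X Y : ℝ}, ‖x‖ ≤ X → ‖y‖ ≤ Y → ‖pairing x y‖ ≤ 4 * (X * Y) :=
    norm_pairing_le
  refine (norm_add_le_of_le (norm_add_le_of_le (norm_mul_le_mul (norm_ofReal_le h₂)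
      (norm_add_le_of_le (norm_mul_le_mul (p hz hv) (p hx hy)) (norm_mul_le_mul (p hx hv) (p hz hy))))
    (norm_mul_le_mul (norm_ofReal_le h₃) (norm_add_le_of_le (norm_add_le_of_le (norm_add_le_of_le
      (norm_mul_le_mul (norm_mul_le_mul (p hz hw) (p hx hy)) (p hw hv))
      (norm_mul_le_mul (norm_mul_le_mul (p hx hw) (p hz hy)) (p hw hv)))
      (norm_mul_le_mul (norm_mul_le_mul (p hx hv) (p hz hw)) (p hw hy)))
      (norm_mul_le_mul (norm_mul_le_mul (p hx hw) (p hz hv)) (p hw hy)))))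
    (norm_mul_le_mul (norm_ofReal_le h₄) (norm_mul_le_mul (norm_mul_le_mul (norm_mul_le_mul (p hx hw)
      (p hz hw)) (p hw hy)) (p hw hv)))).trans_eq ?_
  field_simp
  ring

include hσ hw h₁ h₂ h₃ h₄ in
-- Weight count: `w`, `a p` and `x`, `y` have weights `3`, `1` and `-1` in `σ`, and `c_k` has weight
-- `4 - 6k`. Every term then has weight `-4`.
theorem norm_curvatureForm_le {a : Fin 3 → Fin 4 → ℂ} {A B : ℝ} (ha : ∀ p, ‖a p‖ ≤ A * σ)
    {x y : Fin 4 → ℂ} (hx : ‖x‖ ≤ B / σ) (hy : ‖y‖ ≤ B / σ) (i j k l : Fin 3) :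
    ‖curvatureForm c₁ c₂ c₃ c₄ w a i j k l x y‖ ≤
      (20 * C * B ^ 2 + 192 * C * A ^ 2 * B + 544 * C * A ^ 4 +
        3 * (20 * C * (A * B) + 96 * C * A ^ 3) ^ 2) / σ ^ 4 := by
  have hm := fun {x y : Fin 4 → ℂ} {X Y : ℝ} => @norm_metricForm_le c₁ c₂ C σ w hσ hw h₁ h₂ x y X Y
  have hc := fun {x y z : Fin 4 → ℂ} {X Y Z : ℝ} =>
    @norm_cubicForm_le c₂ c₃ C σ w hσ hw h₂ h₃ x y z X Y Z
  have hs : ∀ {u : ℂ} {X : ℝ}, ‖u‖ ≤ X → ‖star u‖ ≤ X := fun h => by rwa [norm_star]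
  rw [curvatureForm]
  refine (norm_add_le_of_le ((norm_neg _).trans_le (norm_add_le_of_le (norm_add_le_of_le
    (norm_add_le_of_le (hm hx hy) (hc (ha i) hy (ha k))) (hs (hc (ha j) hx (ha l))))
    (norm_quarticForm_le hσ hw h₂ h₃ h₄ (ha i) (ha j) (ha k) (ha l))))
    (norm_sum_le_of_le Finset.univ fun p _ => norm_mul_le_mul
      (norm_add_le_of_le (hm hx (ha p)) (hc (ha i) (ha p) (ha k)))
      (norm_add_le_of_le (hm (ha p) hy) (hs (hc (ha j) (ha p) (ha l)))))).trans_eq ?_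
  rw [Finset.sum_const, Finset.card_univ, Fintype.card_fin, nsmul_eq_mul]
  push_cast
  field_simp
  ring

end Bounds

theorem normSq_pairing_le (x y : Fin 4 → ℂ) : ‖pairing x y‖ ^ 2 ≤ radiusSq x * radiusSq y := by
  have h1 := norm_inner_le_norm (𝕜 := ℂ) (WithLp.toLp 2 y) (WithLp.toLp 2 x)
  have h2 : inner ℂ (WithLp.toLp 2 y) (WithLp.toLp 2 x) = pairing x y := by
    simp [PiLp.inner_apply, pairing]
  have h3 : ∀ v : Fin 4 → ℂ, radiusSq v = ‖WithLp.toLp 2 v‖ ^ 2 := fun v => by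
    rw [EuclideanSpace.norm_sq_eq]; rfl
  rw [h2] at h1
  rw [h3, h3, ← mul_pow, mul_comm]
  exact pow_le_pow_left₀ (norm_nonneg _) h1 2

theorem norm_sq_le_radiusSq (x : Fin 4 → ℂ) : ‖x‖ ^ 2 ≤ radiusSq x := by
  have h0 : 0 ≤ radiusSq x := Finset.sum_nonneg fun _ _ => by positivity
  refine (Real.le_sqrt (norm_nonneg _) h0).1 ((pi_norm_le_iff_of_nonneg (Real.sqrt_nonneg _)).2
    fun m => Real.le_sqrt_of_sq_le ?_)
  exact Finset.single_le_sum (f := fun m => ‖x m‖ ^ 2) (fun _ _ => by positivity)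
    (Finset.mem_univ m)

/-- Tangent vectors of the quadric at `w` are orthogonal to `w̄`, so that only part of `w`
contributes to their pairing with `w`. -/
theorem normSq_pairing_tangent_le {t : ℂ} {w v : Fin 4 → ℂ} (hw : w ∈ quadric t) (hw0 : w ≠ 0)
    (hv : ∑ m, w m * v m = 0) :
    radiusSq w * ‖pairing v w‖ ^ 2 ≤ radiusSq v * (radiusSq w ^ 2 - ‖t‖ ^ 2) := by
  have hs := radiusSq_pos hw0
  have hsc : (radiusSq w : ℂ) ≠ 0 := ofReal_ne_zero.2 hs.ne'
  -- This `α` makes `w + α w̄` orthogonal to `w̄`. Adding a multiple of `w̄` does not change the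
  -- pairing with the tangent vector `v`, so Cauchy–Schwarz applies to this shorter vector.
  set α : ℂ := -(t / radiusSq w) with hα
  have h1 : pairing v (star w) = 0 := by
    rw [← hv]; simp [pairing, mul_comm]
  have h2 : pairing w (star w) = t := by
    rw [← show ∑ i, w i ^ 2 = t from hw]; simp [pairing, sq]
  have h3 : pairing (star w) w = star t := by rw [← h2, star_pairing]
  have h4 : pairing (star w) (star w) = radiusSq w := by
    rw [← pairing_self]; simp [pairing, mul_comm]
  have h5 : pairing v (w + α • star w) = pairing v w := by
    rw [pairing_add_right, pairing_smul_right, h1, mul_zero, add_zero]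
  have h6 : radiusSq w * radiusSq (w + α • star w) = radiusSq w ^ 2 - ‖t‖ ^ 2 := by
    rw [← ofReal_inj]
    push_cast
    rw [← pairing_self (w + _), ← mul_conj' t, pairing_add_left, pairing_smul_left,
      pairing_add_right, pairing_add_right, pairing_smul_right, pairing_smul_right, pairing_self w,
      h2, h3, h4, hα]
    simp only [RCLike.star_def, map_neg, map_div₀, conj_ofReal]
    field_simp
    ring
  have h7 := normSq_pairing_le v (w + α • star w)
  rw [h5] at h7
  calc _ ≤ radiusSq w * (radiusSq v * radiusSq (w + α • star w)) := by gcongr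
    _ = _ := by rw [← h6]; ring

theorem metricForm_self (c₁ c₂ : ℝ) (w v : Fin 4 → ℂ) :
    metricForm c₁ c₂ w v v = ((c₁ * radiusSq v + c₂ * ‖pairing v w‖ ^ 2 : ℝ) : ℂ) := by
  rw [metricForm, pairing_self, ← star_pairing v w]
  push_cast
  rw [← mul_conj']
  rfl

theorem norm_le_radiusSq {t : ℂ} {w : Fin 4 → ℂ} (hw : w ∈ quadric t) : ‖t‖ ≤ radiusSq w := by
  rw [← show ∑ i, w i ^ 2 = t from hw]
  exact (norm_sum_le _ _).trans_eq (Finset.sum_congr rfl fun _ _ => norm_pow _ _)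

theorem ne_zero_of_mem_quadric {t : ℂ} (ht : t ≠ 0) {w : Fin 4 → ℂ} (hw : w ∈ quadric t) :
    w ≠ 0 := by
  rintro rfl
  exact ht (by rw [← show ∑ i, (0 : Fin 4 → ℂ) i ^ 2 = t from hw]; simp)

/-- The metric of the quadric in terms of the ambient Euclidean metric. -/
theorem le_metricForm_self {t : ℂ} (ht : t ≠ 0) {w v : Fin 4 → ℂ} (hw : w ∈ quadric t)
    (hv : ∑ m, w m * v m = 0) {c : ℝ} (hc : c ≤ profileJet t 1 (radiusSq w))
    (hc' : c * (radiusSq w * profileJet t 1 (radiusSq w) ^ 2) ≤ 2 / 3) :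
    c * radiusSq v ≤ profileJet t 1 (radiusSq w) * radiusSq v +
      profileJet t 2 (radiusSq w) * ‖pairing v w‖ ^ 2 := by
  have hw0 := ne_zero_of_mem_quadric ht hw
  have hs := radiusSq_pos hw0
  have hN : 0 ≤ radiusSq v := Finset.sum_nonneg fun _ _ => by positivity
  have hP := normSq_pairing_tangent_le hw hw0 hv
  have hode := profileJet_ode ht hs
  have hf := profileJet_one_pos ht hs
  generalize profileJet t 1 (radiusSq w) = f₁ at *
  generalize profileJet t 2 (radiusSq w) = f₂ at *
  generalize radiusSq w = s at *
  generalize radiusSq v = N at *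
  have hP0 : 0 ≤ ‖pairing v w‖ ^ 2 := by positivity
  generalize ‖pairing v w‖ ^ 2 = P at *
  -- If `f₂ ≥ 0`, the second term only helps. Otherwise it is weighed against the tangential
  -- Cauchy–Schwarz bound, and the Monge–Ampère equation evaluates the resulting coefficient.
  rcases le_total 0 f₂ with h2 | h2
  · nlinarith [mul_nonneg h2 hP0, mul_le_mul_of_nonneg_right hc hN]
  · have h3 : c * s ≤ (s ^ 2 - ‖t‖ ^ 2) * f₂ + s * f₁ := by
      have h5 : 0 < f₁ ^ 2 := by positivity
      refine le_of_mul_le_mul_left ?_ h5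
      rw [hode]
      linarith
    have h4 : s * (c * N) ≤ s * (f₁ * N + f₂ * P) := by
      nlinarith [mul_le_mul_of_nonneg_right h3 hN, mul_le_mul_of_nonpos_left hP h2]
    exact le_of_mul_le_mul_left h4 hs

end Conifold

/-! ### The metric and its curvature in holomorphic charts. -/

namespace Conifold

/-- The derivative of the relation `A · B = const` between holomorphic maps to `ℂ⁴`. -/
theorem sum_partialDeriv_mul_add {A B : (Fin 3 → ℂ) → Fin 4 → ℂ} {z : Fin 3 → ℂ} {c : ℂ}
    (hA : DifferentiableAt ℂ A z) (hB : DifferentiableAt ℂ B z)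
    (h : ∀ᶠ x in nhds z, ∑ m, A x m * B x m = c) (i : Fin 3) :
    ∑ m, partialDeriv i A z m * B z m + ∑ m, A z m * partialDeriv i B z m = 0 := by
  have hA' := fun m => (hasFDerivAt_pi'.1 hA.hasFDerivAt m)
  have hB' := fun m => (hasFDerivAt_pi'.1 hB.hasFDerivAt m)
  have h1 := HasFDerivAt.fun_sum (u := Finset.univ) fun m _ => (hA' m).mul (hB' m)
  have h2 := h1.unique ((hasFDerivAt_const c z).congr_of_eventuallyEq h)
  have h3 := DFunLike.congr_fun h2 (Pi.single i 1)
  rw [← Finset.sum_add_distrib]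
  simp only [sum_apply, add_apply, smul_apply, zero_apply,
    ContinuousLinearMap.comp_apply, ContinuousLinearMap.proj_apply, smul_eq_mul] at h3
  rw [← h3]
  exact Finset.sum_congr rfl fun m _ => by rw [partialDeriv, partialDeriv]; ring

theorem fderiv_eq_sum_partialDeriv (W : (Fin 3 → ℂ) → Fin 4 → ℂ) (z y : Fin 3 → ℂ) :
    fderiv ℂ W z y = ∑ i, y i • partialDeriv i W z := by
  conv_lhs => rw [pi_eq_sum_univ' y]
  simp only [map_sum, map_smul, partialDeriv]

theorem metricForm_sum_sum (c₁ c₂ : ℝ) (w : Fin 4 → ℂ) (a : Fin 3 → Fin 4 → ℂ) (c d : Fin 3 → ℂ) :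
    metricForm c₁ c₂ w (∑ p, c p • a p) (∑ q, d q • a q) =
      ∑ p, ∑ q, c p * metricForm c₁ c₂ w (a p) (a q) * star (d q) := by
  simp only [Fin.sum_univ_three, metricForm_add_left, metricForm_add_right, metricForm_smul_left,
    metricForm_smul_right]
  ring

section Chart

variable {t : ℂ} (ht : t ≠ 0) {e : OpenPartialHomeomorph (quadric t) (Fin 3 → ℂ)}
  (he : IsHolomorphicChart e)

/-- The parametrisation of `quadric t` by the coordinates `e`. -/
noncomputable def param (e : OpenPartialHomeomorph (quadric t) (Fin 3 → ℂ)) (z : Fin 3 → ℂ) :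
    Fin 4 → ℂ :=
  (e.symm z : Fin 4 → ℂ)

theorem param_mem (e : OpenPartialHomeomorph (quadric t) (Fin 3 → ℂ)) (z : Fin 3 → ℂ) :
    param e z ∈ quadric t :=
  (e.symm z).2

include ht in
theorem potential_eq (z : Fin 3 → ℂ) :
    potential e z = profileJet t 0 (radiusSq (param e z)) :=
  profile_eq_profileJet ht (norm_le_radiusSq (param_mem e z))

include he in
theorem tangent_partialDeriv_param {z : Fin 3 → ℂ} (hz : z ∈ e.target) (i : Fin 3) :
    ∑ m, param e z m * partialDeriv i (param e) z m = 0 := by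
  have hd := he.1.differentiableAt (e.open_target.mem_nhds hz)
  have h := sum_partialDeriv_mul_add (A := param e) (B := param e) hd hd (c := t)
    (Filter.Eventually.of_forall fun x => by simpa [quadric, sq] using param_mem e x) i
  simp only [mul_comm (partialDeriv i (param e) z _)] at h
  exact add_self_eq_zero.1 h

include he in
-- The second derivative of `W · W = t`: first derivatives determine the part of a second derivative
-- transverse to the quadric.
theorem sum_param_mul_partialDeriv_partialDeriv {z : Fin 3 → ℂ} (hz : z ∈ e.target)
    (i k : Fin 3) :
    ∑ m, param e z m * partialDeriv k (partialDeriv i (param e)) z m =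
      -∑ m, partialDeriv k (param e) z m * partialDeriv i (param e) z m := by
  have hd := he.1.differentiableAt (e.open_target.mem_nhds hz)
  have hdi := (differentiableOn_partialDeriv e.open_target (W := param e) he.1 i).differentiableAt
    (e.open_target.mem_nhds hz)
  have h := sum_partialDeriv_mul_add (A := param e) (B := partialDeriv i (param e)) hd hdi (c := 0)
    (Filter.eventually_of_mem (e.open_target.mem_nhds hz) fun x hx =>
      tangent_partialDeriv_param he hx i) k
  linear_combination h

include ht he in
theorem kahlerMatrix_potential_eq {z : Fin 3 → ℂ} (hz : z ∈ e.target) (i j : Fin 3) :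
    kahlerMatrix (potential e) z i j = metricForm (profileJet t 1 (radiusSq (param e z)))
      (profileJet t 2 (radiusSq (param e z))) (param e z) (partialDeriv i (param e) z)
      (partialDeriv j (param e) z) :=
  kahlerMatrix_eq_metricForm e.open_target (W := param e) he.1
    (fun z _ => ne_zero_of_mem_quadric ht (param_mem e z))
    (fun k _ hs => hasDerivAt_profileJet ht k hs) (fun z _ => potential_eq ht z) hz i j

include ht he in
theorem contDiffOn_potential : ContDiffOn ℝ ∞ (potential e) e.target := by
  have h1 : ContDiffOn ℝ ∞ (param e) e.target :=
    (contDiffOn_infty_of_differentiableOn_complex e.open_target he.1).restrict_scalars ℝ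
  have h2 : ContDiff ℝ ∞ radiusSq := by
    unfold radiusSq
    exact ContDiff.sum fun m _ => (contDiff_norm_sq ℝ).comp (contDiff_apply ℝ ℂ m)
  refine ((contDiffOn_profileJet ht 0).comp (h2.comp_contDiffOn h1) fun z _ =>
    radiusSq_pos (ne_zero_of_mem_quadric ht (param_mem e z))).congr fun z _ => potential_eq ht z

include ht he in
theorem posDef_kahlerMatrix {z : Fin 3 → ℂ} (hz : z ∈ e.target) :
    (kahlerMatrix (potential e) z).PosDef := by
  refine Matrix.PosDef.of_dotProduct_mulVec_pos ?_ fun x hx => ?_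
  · ext i j
    rw [Matrix.conjTranspose_apply, kahlerMatrix_potential_eq ht he hz,
      kahlerMatrix_potential_eq ht he hz, star_metricForm]
  -- The conjugate is needed because the metric form is linear in its first argument, while `star x`
  -- stands on the left of the matrix.
  · set v := fderiv ℂ (param e) z (star x) with hv
    have hv0 : v ≠ 0 := by
      intro h
      have := he.2 z hz (h.trans (map_zero (fderiv ℂ (param e) z)).symm)
      exact hx (by simpa using this)
    have hvs : v = ∑ i, star x i • partialDeriv i (param e) z := fderiv_eq_sum_partialDeriv _ _ _
    have h1 : star x ⬝ᵥ Matrix.mulVec (kahlerMatrix (potential e) z) x =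
        metricForm (profileJet t 1 (radiusSq (param e z)))
          (profileJet t 2 (radiusSq (param e z))) (param e z) v v := by
      rw [hvs, metricForm_sum_sum]
      simp only [dotProduct, Matrix.mulVec, Finset.mul_sum, kahlerMatrix_potential_eq ht he hz,
        Pi.star_apply, star_star, mul_assoc]
    have htan : ∑ m, param e z m * v m = 0 := by
      rw [hvs]
      simp only [Finset.sum_apply, Pi.smul_apply, smul_eq_mul, Finset.mul_sum]
      rw [Finset.sum_comm]
      refine Finset.sum_eq_zero fun i _ => ?_
      have := tangent_partialDeriv_param he hz i
      calc _ = star x i * ∑ m, param e z m * partialDeriv i (param e) z m := by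
            rw [Finset.mul_sum]; exact Finset.sum_congr rfl fun m _ => by ring
        _ = 0 := by rw [this, mul_zero]
    have hs := radiusSq_pos (ne_zero_of_mem_quadric ht (param_mem e z))
    have hf := profileJet_one_pos ht hs
    have hN := radiusSq_pos hv0
    rw [h1, metricForm_self]
    refine Complex.zero_lt_real.2 ?_
    set f₁ := profileJet t 1 (radiusSq (param e z)) with hf₁
    have hD : 0 < radiusSq (param e z) * f₁ ^ 2 := by positivity
    -- The largest constant that `le_metricForm_self` admits at this point; positivity needs no
    -- uniformity.
    have hc : 0 < min f₁ (2 / 3 / (radiusSq (param e z) * f₁ ^ 2)) := by positivity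
    refine (mul_pos hc hN).trans_le (le_metricForm_self ht (param_mem e z) htan (min_le_left _ _) ?_)
    rw [← le_div_iff₀ hD]
    exact min_le_right _ _

include ht he in
-- At a point where the matrix is the identity so is its inverse, and the double sum becomes a sum
-- over `p`.
theorem curvature_potential_eq {z : Fin 3 → ℂ} (hz : z ∈ e.target)
    (h1 : kahlerMatrix (potential e) z = 1) (i j k l : Fin 3) :
    curvature (potential e) z i j k l =
      curvatureForm (profileJet t 1 (radiusSq (param e z))) (profileJet t 2 (radiusSq (param e z)))
        (profileJet t 3 (radiusSq (param e z))) (profileJet t 4 (radiusSq (param e z)))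
        (param e z) (fun p => partialDeriv p (param e) z) i j k l
        (partialDeriv k (partialDeriv i (param e)) z)
        (partialDeriv l (partialDeriv j (param e)) z) := by
  have hW0 : ∀ z ∈ e.target, param e z ≠ 0 := fun z _ => ne_zero_of_mem_quadric ht (param_mem e z)
  have hf := fun k s (hs : s > 0) => hasDerivAt_profileJet ht k hs
  have hF : ∀ z ∈ e.target, potential e z = profileJet t 0 (radiusSq (param e z)) :=
    fun z _ => potential_eq ht z
  have hg := hasWirtingerAt_kahlerMatrix e.open_target (W := param e) he.1 hW0 hf hF hz
  rw [curvature, curvatureForm, h1, inv_one,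
    wirtinger_wirtingerBar_kahlerMatrix e.open_target (W := param e) he.1 hW0 hf hF hz]
  congr 1
  simp only [Matrix.one_apply, ite_mul, one_mul, zero_mul, Finset.sum_ite_eq', Finset.mem_univ,
    if_true]
  exact Finset.sum_congr rfl fun p _ => by
    rw [(hg i p).wirtinger_eq k, (hg p j).wirtingerBar_eq l]

end Chart

theorem norm_dot_le {x y : Fin 4 → ℂ} {X Y : ℝ} (hx : ‖x‖ ≤ X) (hy : ‖y‖ ≤ Y) :
    ‖∑ m, x m * y m‖ ≤ 4 * (X * Y) := by
  have := norm_pairing_le hx (y := star y) ((norm_star y).trans_le hy)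
  simpa only [pairing, Pi.star_apply, star_star] using this

theorem exists_curvature_bound : ∃ K : ℝ, ∀ t : ℂ, t ≠ 0 →
    ∀ e : OpenPartialHomeomorph (quadric t) (Fin 3 → ℂ), IsHolomorphicChart e →
    ∀ z ∈ e.target, kahlerMatrix (potential e) z = 1 →
    ∀ σ : ℝ, 0 < σ → σ ^ 6 = radiusSq (param e z) → ∀ i j k l : Fin 3,
      ‖curvature (potential e) z i j k l‖ ≤ K / σ ^ 4 := by
  obtain ⟨C, hC⟩ := exists_profileJet_bound
  -- With `c = κ / σ²`, the two entries of the minimum match the two conditions of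
  -- `le_metricForm_self`, given `1/2 ≤ σ² f_t' ≤ C`. Then `A = κ^(-1/2)` bounds orthonormal
  -- vectors, and `B` the transverse part of second derivatives.
  set κ : ℝ := min (1 / 2) (2 / 3 / C ^ 2) with hκ
  set A : ℝ := √(1 / κ) with hA
  set B : ℝ := 4 * A ^ 2 with hB
  refine ⟨20 * C * B ^ 2 + 192 * C * A ^ 2 * B + 544 * C * A ^ 4 +
    3 * (20 * C * (A * B) + 96 * C * A ^ 3) ^ 2, fun t ht e he z hz h1 σ hσ hσs i j k l => ?_⟩
  have hw := param_mem e z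
  have hw0 := ne_zero_of_mem_quadric ht hw
  obtain ⟨hlow, hb⟩ := hC t ht (radiusSq (param e z)) σ (norm_le_radiusSq hw) hσ hσs
  have hs := radiusSq_pos hw0
  have hf := profileJet_one_pos ht hs
  have hb' : ∀ k ≤ 3, |profileJet t (k + 1) (radiusSq (param e z))| ≤ C / σ ^ (6 * k + 2) :=
    fun k hk => (le_div_iff₀ (by positivity)).2 (hb k hk)
  rw [curvature_potential_eq ht he hz h1]
  set w := param e z with hwd
  set a : Fin 3 → Fin 4 → ℂ := fun p => partialDeriv p (param e) z with had
  have hup : σ ^ 2 * profileJet t 1 (radiusSq w) ≤ C := by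
    have := hb 0 (by norm_num)
    rw [abs_of_pos hf] at this
    simpa [mul_comm] using this
  have hCpos : 0 < C := by linarith
  have hκ0 : 0 < κ := by positivity
  have hnw : ‖w‖ ≤ σ ^ 3 := by
    refine le_of_sq_le_sq ?_ (by positivity)
    rw [← pow_mul, hσs]
    exact norm_sq_le_radiusSq w
  have ha : ∀ p q, metricForm (profileJet t 1 (radiusSq w)) (profileJet t 2 (radiusSq w)) w
      (a p) (a q) = if p = q then 1 else 0 := fun p q => by
    rw [← Matrix.one_apply, ← h1, kahlerMatrix_potential_eq ht he hz]
  have htan : ∀ p, ∑ m, w m * a p m = 0 := fun p => tangent_partialDeriv_param he hz p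
  have hna : ∀ p, ‖a p‖ ≤ A * σ := by
    intro p
    have h2 := ha p p
    rw [if_pos rfl, metricForm_self, ofReal_eq_one] at h2
    have h3 := le_metricForm_self ht hw (htan p) (c := κ / σ ^ 2) (by
      rw [div_le_iff₀ (by positivity), mul_comm]
      exact (min_le_left _ _).trans hlow) (by
      rw [← hσs]
      calc κ / σ ^ 2 * (σ ^ 6 * profileJet t 1 (σ ^ 6) ^ 2) =
            κ * (σ ^ 2 * profileJet t 1 (σ ^ 6)) ^ 2 := by field_simp
        _ ≤ (2 / 3 / C ^ 2) * C ^ 2 := by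
            rw [hσs]
            gcongr
            exact min_le_right _ _
        _ = 2 / 3 := by field_simp)
    rw [h2] at h3
    refine le_of_sq_le_sq ?_ (by positivity)
    rw [mul_pow, hA, Real.sq_sqrt (by positivity)]
    refine (norm_sq_le_radiusSq _).trans ?_
    rw [div_mul_eq_mul_div, div_le_iff₀ (by positivity)] at h3
    rw [div_mul_eq_mul_div, le_div_iff₀ hκ0]
    linarith
  have hli := linearIndependent_of_orthonormal ha
  -- Split a second derivative into a controlled multiple `β` of `w̄` and an uncontrolled tangent
  -- vector, which the curvature ignores.
  have hdecomp : ∀ i k, ∃ c : Fin 3 → ℂ, ∃ β : Fin 4 → ℂ, ‖β‖ ≤ B / σ ∧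
      partialDeriv k (partialDeriv i (param e)) z = β + ∑ p, c p • a p := by
    intro i k
    set b := partialDeriv k (partialDeriv i (param e)) z with hbd
    -- Since `w · w̄ = r²`, this is the coefficient for which `b - μ w̄` is tangent.
    set μ : ℂ := (∑ m, w m * b m) / radiusSq w with hμ
    have hww : ∑ m, w m * star (w m) = radiusSq w := pairing_self w
    obtain ⟨c, hc⟩ := exists_eq_sum_of_tangent hw0 hli htan (v := b - μ • star w) (by
      have h4 : ∑ m, w m * (b - μ • star w) m =
          ∑ m, w m * b m - μ * ∑ m, w m * star (w m) := by
        rw [Finset.mul_sum, ← Finset.sum_sub_distrib]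
        exact Finset.sum_congr rfl fun m _ => by
          simp only [Pi.sub_apply, Pi.smul_apply, Pi.star_apply, smul_eq_mul]; ring
      rw [h4, hww, hμ, div_mul_cancel₀ _ (ofReal_ne_zero.2 hs.ne'), sub_self])
    refine ⟨c, μ • star w, ?_, by rw [← hc]; abel⟩
    have h5 : ∑ m, w m * b m = -∑ m, a k m * a i m :=
      sum_param_mul_partialDeriv_partialDeriv he hz i k
    have h6 := norm_dot_le (hna k) (hna i)
    rw [norm_smul, norm_star, hμ, h5, norm_div, norm_neg, norm_real, Real.norm_of_nonneg hs.le]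
    calc _ ≤ 4 * (A * σ * (A * σ)) / radiusSq w * σ ^ 3 := by gcongr
      _ = B / σ := by rw [← hσs, hB]; field_simp
  obtain ⟨c, β, hβ, hc⟩ := hdecomp i k
  obtain ⟨d, γ, hγ, hd⟩ := hdecomp j l
  rw [hc, hd, curvatureForm_add_sum ha]
  exact norm_curvatureForm_le hσ hnw (hb' 0 (by norm_num)) (hb' 1 (by norm_num))
    (hb' 2 (by norm_num)) (hb' 3 (by norm_num)) hna hβ hγ i j k l

end Conifold

/-! ### Existence of orthonormal charts. -/

namespace Conifold

theorem sqrt_pow_two (x : ℂ) : sqrt x ^ 2 = x := by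
  simp [sqrt]

theorem sqrt_sq_of_re_pos {x : ℂ} (hx : 0 < x.re) : sqrt (x ^ 2) = x := sq_cpow_two_inv hx

theorem sqrt_re_pos {x : ℂ} (hx : x ∈ slitPlane) : 0 < (sqrt x).re := by
  rw [sqrt, cpow_inv_two_re]
  refine Real.sqrt_pos.2 (half_pos ?_)
  rcases mem_slitPlane_iff.1 hx with h | h
  · linarith [norm_nonneg x]
  · have h1 : |x.re| < ‖x‖ := abs_re_lt_norm.2 h
    linarith [neg_abs_le x.re]

theorem sq_mem_slitPlane {x : ℂ} (hx : 0 < x.re) : x ^ 2 ∈ slitPlane := by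
  rw [mem_slitPlane_iff]
  by_cases h : x.im = 0
  · left
    rw [sq, mul_re, h]
    nlinarith
  · right
    rw [sq, mul_im]
    intro h'
    have : x.re * x.im = 0 := by linarith
    rcases mul_eq_zero.1 this with h2 | h2
    · exact hx.ne' h2
    · exact h h2

/-- The point of `quadric t` with given coordinates other than the `m`-th one. -/
noncomputable def liftPoint (t c : ℂ) (m : Fin 4) (z : Fin 3 → ℂ) : Fin 4 → ℂ :=
  m.insertNth (α := fun _ => ℂ) (c * sqrt ((t - ∑ i, z i ^ 2) / c ^ 2)) z

theorem liftPoint_mem {t c : ℂ} (hc : c ≠ 0) (m : Fin 4) (z : Fin 3 → ℂ) :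
    liftPoint t c m z ∈ quadric t := by
  change ∑ i, liftPoint t c m z i ^ 2 = t
  rw [Fin.sum_univ_succAbove _ m]
  simp only [liftPoint, Fin.insertNth_apply_same, Fin.insertNth_apply_succAbove]
  rw [mul_pow, sqrt_pow_two]
  field_simp
  ring

theorem sub_sum_removeNth_sq {t : ℂ} {v : Fin 4 → ℂ} (hv : v ∈ quadric t) (m : Fin 4) :
    t - ∑ i, m.removeNth v i ^ 2 = v m ^ 2 := by
  rw [← show ∑ i, v i ^ 2 = t from hv, Fin.sum_univ_succAbove _ m]
  simp only [Fin.removeNth_apply]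
  ring

theorem continuous_coord (t : ℂ) (i : Fin 4) :
    Continuous fun v : quadric t => (v : Fin 4 → ℂ) i :=
  (continuous_apply i).comp continuous_subtype_val

/-- The coordinates on the part of `quadric t` near a point whose `m`-th coordinate is `c ≠ 0`,
obtained by dropping the `m`-th coordinate. -/
noncomputable def dropChart (t : ℂ) {c : ℂ} (hc : c ≠ 0) (m : Fin 4) :
    OpenPartialHomeomorph (quadric t) (Fin 3 → ℂ) where
  toFun v := m.removeNth (v : Fin 4 → ℂ)
  invFun z := ⟨liftPoint t c m z, liftPoint_mem hc m z⟩
  -- Dividing by `c` puts the base point at `1`. Squaring maps the right half-plane bijectively onto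
  -- the slit plane, with the principal root as inverse.
  source := {v | 0 < ((v : Fin 4 → ℂ) m / c).re}
  target := {z | (t - ∑ i, z i ^ 2) / c ^ 2 ∈ slitPlane}
  map_source' v hv := by
    have h := sub_sum_removeNth_sq v.2 m
    simp only [Set.mem_ofPred_eq]
    rw [h, ← div_pow]
    exact sq_mem_slitPlane hv
  map_target' z hz := by
    simp only [Set.mem_ofPred_eq, liftPoint, Fin.insertNth_apply_same]
    rw [mul_div_cancel_left₀ _ hc]
    exact sqrt_re_pos hz
  left_inv' v hv := by
    refine Subtype.ext ?_
    have h := sub_sum_removeNth_sq v.2 m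
    simp only [liftPoint]
    rw [h, ← div_pow, sqrt_sq_of_re_pos hv, mul_div_cancel₀ _ hc]
    exact Fin.insertNth_self_removeNth _ _
  right_inv' z _ := Fin.removeNth_insertNth _ _ _
  open_source := isOpen_lt continuous_const
    (continuous_re.comp ((continuous_coord t m).div_const c))
  open_target := isOpen_slitPlane.preimage (by fun_prop)
  continuousOn_toFun := Continuous.continuousOn
    (continuous_pi fun i => continuous_coord t (m.succAbove i))
  continuousOn_invFun := by
    rw [Topology.IsInducing.subtypeVal.continuousOn_iff]
    refine ContinuousOn.finInsertNth m (ContinuousOn.mul continuousOn_const ?_) continuousOn_id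
    exact continuousOn_sqrt.comp (Continuous.continuousOn (by fun_prop)) fun z hz => hz

theorem isHolomorphicChart_dropChart (t : ℂ) {c : ℂ} (hc : c ≠ 0) (m : Fin 4) :
    IsHolomorphicChart (dropChart t hc m) := by
  have hd : DifferentiableOn ℂ (liftPoint t c m) (dropChart t hc m).target := by
    intro z hz
    refine DifferentiableAt.differentiableWithinAt (differentiableAt_pi.2 fun i => ?_)
    rcases Fin.eq_self_or_eq_succAbove m i with rfl | ⟨j, rfl⟩
    · simp only [liftPoint, Fin.insertNth_apply_same]
      exact (DifferentiableAt.comp (g := sqrt) z (differentiableAt_sqrt hz)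
        (by fun_prop)).const_mul c
    · simp only [liftPoint, Fin.insertNth_apply_succAbove]
      fun_prop
  refine ⟨hd, fun z hz x y hxy => ?_⟩
  have hdz := hd.differentiableAt ((dropChart t hc m).open_target.mem_nhds hz)
  funext j
  -- Forgetting the `m`-th coordinate is a left inverse of the parametrisation; comparing
  -- derivatives gives injectivity.
  have h1 : HasFDerivAt (fun z => liftPoint t c m z (m.succAbove j)) _ z :=
    hasFDerivAt_pi'.1 hdz.hasFDerivAt (m.succAbove j)
  have h2 : HasFDerivAt (fun z => liftPoint t c m z (m.succAbove j))
      (ContinuousLinearMap.proj (R := ℂ) (φ := fun _ : Fin 3 => ℂ) j) z := by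
    simp only [liftPoint, Fin.insertNth_apply_succAbove]
    exact hasFDerivAt_apply j z
  have h3 := h1.unique h2
  have hx := DFunLike.congr_fun h3 x
  have hy := DFunLike.congr_fun h3 y
  simp only [ContinuousLinearMap.comp_apply, ContinuousLinearMap.proj_apply] at hx hy
  have hxy' : fderiv ℂ (liftPoint t c m) z x = fderiv ℂ (liftPoint t c m) z y := hxy
  rw [← hx, ← hy, hxy']

theorem mem_dropChart_source {t : ℂ} (w : quadric t) {m : Fin 4} (hm : (w : Fin 4 → ℂ) m ≠ 0) :
    w ∈ (dropChart t hm m).source := by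
  change 0 < ((w : Fin 4 → ℂ) m / (w : Fin 4 → ℂ) m).re
  rw [div_self hm]
  exact one_pos

open scoped MatrixOrder Matrix.Norms.L2Operator in
theorem exists_eq_conjTranspose_mul_self {M : Matrix (Fin 3) (Fin 3) ℂ} (hM : M.PosDef) :
    ∃ N : Matrix (Fin 3) (Fin 3) ℂ, IsUnit N ∧ M = N.conjTranspose * N :=
  CStarAlgebra.isStrictlyPositive_iff_eq_star_mul_self.1
    (Matrix.isStrictlyPositive_iff_posDef.2 hM)

/-- A linear change of coordinates acts on the metric by congruence. -/
theorem isOrthonormalChartAt_transHomeomorph {t : ℂ} (ht : t ≠ 0)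
    {e : OpenPartialHomeomorph (quadric t) (Fin 3 → ℂ)} (he : IsHolomorphicChart e)
    {w : quadric t} (hw : w ∈ e.source) (L : (Fin 3 → ℂ) ≃L[ℂ] (Fin 3 → ℂ))
    (hL : ∀ i j, ∑ p, ∑ q, L.symm (Pi.single i 1) p * kahlerMatrix (potential e) (e w) p q *
      star (L.symm (Pi.single j 1) q) = if i = j then 1 else 0) :
    IsOrthonormalChartAt (e.transHomeomorph L.toHomeomorph) w := by
  have hd : ∀ z ∈ (e.transHomeomorph L.toHomeomorph).target,
      HasFDerivAt (param (e.transHomeomorph L.toHomeomorph))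
        ((fderiv ℂ (param e) (L.symm z)).comp (L.symm : (Fin 3 → ℂ) →L[ℂ] (Fin 3 → ℂ))) z := by
    intro z hz
    have h1 := (he.1.differentiableAt (e.open_target.mem_nhds hz)).hasFDerivAt
    exact h1.comp z L.symm.hasFDerivAt
  have hch : IsHolomorphicChart (e.transHomeomorph L.toHomeomorph) := by
    refine ⟨fun z hz => (hd z hz).differentiableAt.differentiableWithinAt, fun z hz => ?_⟩
    have h1 : fderiv ℂ (param (e.transHomeomorph L.toHomeomorph)) z = _ := (hd z hz).fderiv
    change Function.Injective (fderiv ℂ (param (e.transHomeomorph L.toHomeomorph)) z)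
    rw [h1]
    exact (he.2 _ hz).comp L.symm.injective
  have hsrc : w ∈ (e.transHomeomorph L.toHomeomorph).source := hw
  refine ⟨hch, hsrc, ?_⟩
  have htgt := (e.transHomeomorph L.toHomeomorph).map_source hsrc
  have hsymm : L.symm ((e.transHomeomorph L.toHomeomorph) w) = e w := L.symm_apply_apply (e w)
  ext i j
  have hp : ∀ i, partialDeriv i (param (e.transHomeomorph L.toHomeomorph))
      ((e.transHomeomorph L.toHomeomorph) w) =
      ∑ p, L.symm (Pi.single i 1) p • partialDeriv p (param e) (e w) := by
    intro i
    rw [partialDeriv, (hd _ htgt).fderiv, hsymm, ← fderiv_eq_sum_partialDeriv]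
    rfl
  have hpar : param (e.transHomeomorph L.toHomeomorph) ((e.transHomeomorph L.toHomeomorph) w) =
      param e (e w) := by
    rw [← hsymm]; rfl
  rw [kahlerMatrix_potential_eq ht hch htgt, hp, hp, hpar, metricForm_sum_sum, Matrix.one_apply,
    ← hL]
  simp only [kahlerMatrix_potential_eq ht he (e.map_source hw)]

theorem exists_isOrthonormalChartAt {t : ℂ} (ht : t ≠ 0) (w : quadric t) :
    ∃ e : OpenPartialHomeomorph (quadric t) (Fin 3 → ℂ), IsOrthonormalChartAt e w := by
  obtain ⟨m, hm⟩ := Function.ne_iff.1 (ne_zero_of_mem_quadric ht w.2)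
  have he := isHolomorphicChart_dropChart t hm m
  have hw := mem_dropChart_source w hm
  set e := dropChart t hm m
  obtain ⟨N, hN, hM⟩ := exists_eq_conjTranspose_mul_self
    (posDef_kahlerMatrix ht he (e.map_source hw))
  have hNdet : IsUnit N.det := (Matrix.isUnit_iff_isUnit_det N).1 hN
  have hNN : N * N⁻¹ = 1 := Matrix.mul_nonsing_inv N hNdet
  have hNN' : N⁻¹ * N = 1 := Matrix.nonsing_inv_mul N hNdet
  have hmap : ∀ P Q : Matrix (Fin 3) (Fin 3) ℂ, P * Q = 1 →
      P.map (starRingEnd ℂ) * Q.map (starRingEnd ℂ) = 1 := fun P Q h => by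
    rw [← Matrix.map_mul, h]
    exact Matrix.map_one _ (map_zero _) (map_one _)
  -- The inverse map has the entrywise conjugate of `N⁻¹` as its matrix: indices of the metric
  -- transform linearly in the first slot, so this gives `(N⁻¹)ᴴ M N⁻¹ = 1`.
  let L₀ : (Fin 3 → ℂ) ≃ₗ[ℂ] (Fin 3 → ℂ) :=
    Matrix.toLin'OfInv (hmap _ _ hNN') (hmap _ _ hNN)
  refine ⟨e.transHomeomorph L₀.toContinuousLinearEquiv.toHomeomorph,
    isOrthonormalChartAt_transHomeomorph ht he hw _ fun i j => ?_⟩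
  have hL : ∀ i p, L₀.toContinuousLinearEquiv.symm (Pi.single i 1) p = star (N⁻¹ p i) := by
    intro i p
    change Matrix.toLin' (N⁻¹.map (starRingEnd ℂ)) (Pi.single i 1) p = _
    simp
  have h1 : (N⁻¹).conjTranspose * (N.conjTranspose * N) * N⁻¹ = 1 := by
    rw [← Matrix.mul_assoc, ← Matrix.conjTranspose_mul, hNN, Matrix.mul_assoc, hNN]
    simp
  rw [← Matrix.one_apply, ← h1, ← hM]
  simp only [hL, star_star, Matrix.mul_apply, Matrix.conjTranspose_apply, Finset.sum_mul]
  rw [Finset.sum_comm]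

/-- Translates the weight `σ⁻⁴` back to the radius, with `σ = (r²)^(1/6)`. -/
theorem radiusSq_rpow_pow_four {w : Fin 4 → ℂ} (hw : w ≠ 0) :
    1 / (radiusSq w ^ (1 / 6 : ℝ)) ^ 4 = radius w ^ (-(4 / 3) : ℝ) := by
  have hs := radiusSq_pos hw
  rw [radius, Real.sqrt_eq_rpow, ← Real.rpow_mul hs.le, ← Real.rpow_natCast, ← Real.rpow_mul hs.le,
    one_div, ← Real.rpow_neg hs.le]
  norm_num

end Conifold

theorem mainTheorem5 :
    ∃ C : ℝ, ∀ t : ℂ, t ≠ 0 →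
      (∀ e : OpenPartialHomeomorph (Conifold.quadric t) (Fin 3 → ℂ),
        Conifold.IsHolomorphicChart e →
          ContDiffOn ℝ ∞ (Conifold.potential e) e.target ∧
          ∀ z ∈ e.target, (Conifold.kahlerMatrix (Conifold.potential e) z).PosDef) ∧
      ∀ w : Conifold.quadric t,
        (∃ e : OpenPartialHomeomorph (Conifold.quadric t) (Fin 3 → ℂ),
          Conifold.IsOrthonormalChartAt e w) ∧
        ∀ e : OpenPartialHomeomorph (Conifold.quadric t) (Fin 3 → ℂ),
          Conifold.IsOrthonormalChartAt e w →
            ∀ i j k l : Fin 3,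
              ‖Conifold.curvature (Conifold.potential e) (e w) i j k l‖ ≤
                C * Conifold.radius (w : Fin 4 → ℂ) ^ (-(4 / 3) : ℝ) := by
  obtain ⟨K, hK⟩ := Conifold.exists_curvature_bound
  refine ⟨K, fun t ht => ⟨fun e he => ⟨Conifold.contDiffOn_potential ht he,
    fun z hz => Conifold.posDef_kahlerMatrix ht he hz⟩,
    fun w => ⟨Conifold.exists_isOrthonormalChartAt ht w, fun e he i j k l => ?_⟩⟩⟩
  obtain ⟨hch, hw, h1⟩ := he
  have hw0 := Conifold.ne_zero_of_mem_quadric ht w.2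
  have hs := Conifold.radiusSq_pos hw0
  have hpar : Conifold.param e (e w) = w := congrArg Subtype.val (e.left_inv hw)
  rw [← Conifold.radiusSq_rpow_pow_four hw0, mul_one_div]
  refine hK t ht e hch (e w) (e.map_source hw) h1 _ (Real.rpow_pos_of_pos hs _) ?_ i j k l
  rw [hpar, ← Real.rpow_natCast, ← Real.rpow_mul hs.le]
  norm_num
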